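/- Let $\tau$ be in the upper half-plane, $\Lambda=\mathbb Z+\mathbb Z\tau$, $\mathbb T=\mathbb C/\Lambda$, let $\wp$ be the Weierstrass function with periods $1,\tau$, and let $\gamma$ be the segment from $\tau/2$ to $\tau/2+1$, oriented in this direction. The weight is ${\sf w}\equiv 1$. Put $\mathcal E_{2k}=\wp^k$, $\mathcal E_{2k+3}=-\tfrac12\wp'\wp^k$ ($k\ge0$), $\mu_{i,j}=\int_\gamma\mathcal E_i\mathcal E_j\,dz$ and $D_m=\det(\mu_{i,j})_{i,j\in\{0,2,3,\dots,m-1\}}$. For $m\ge2$ let $\pi_m$ denote the elliptic orthogonal polynomial of degree $m$: an elliptic function with periods $1,\tau$ whose poles all lie in $\Lambda$, with $\pi_m(z)=z^{-m}(1+\mathcal O(z))$ as $z\to0$ and $\int_\gamma\pi_m\mathcal E_j\,dz=0$ for all $j<m$, $j\neq1$. Put $h_m=\int_\gamma\pi_m^2\,dz$. Let $Y_m$ be the solution of the Riemann–Hilbert problem of index $m$: $Y_m$ is a $2\times2$ matrix function, analytic on $\mathbb T\setminus(\gamma\cup\{0\})$, with boundary values on $\gamma$ satisfying $Y_{m,+}=Y_{m,-}\begin{pmatrix}1&1\\0&1\end{pmatrix}$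 ($+$ is the left side of $\gamma$), and $Y_m(z)=(\mathbb 1+\mathcal O(z))\begin{pmatrix}z^{-m}&0\\0&z^{m-2}\end{pmatrix}$ as $z\to0$. Put $f_m=\det Y_m$. **Proposition.** Let $n\ge3$ and suppose that $D_{n-1}$, $D_n$ and $D_{n+1}$ are nonzero. Then $h_{n-1}\ne0$, $h_n\neq0$, each $f_m$ with $m\in\{n-1,n,n+1\}$ has the form $f_m=\wp+\alpha_m$ with a constant $\alpha_m$ (and so extends to $\mathbb C\setminus\Lambda$), and $$Y_n'=L_nY_n,\qquad L_n=\frac1{f_n}\begin{pmatrix} \tfrac n2\wp' & \frac{h_n}{2\pi i}\big((n-1)f_n+nf_{n+1}\big)\\[2pt] \frac{2\pi i}{h_{n-1}}\big((2-n)f_{n-1}+(1-n)f_n\big) & \tfrac{2-n}2\wp'\end{pmatrix}$$ at every point of $\mathbb T\setminus(\gamma\cup\{0\})$ where $f_n\ne0$, where ${}'=d/dz$. Moreover, at every $z\notin\Lambda$ with $f_n(z)\neq0$ and $(n-1)f_n(z)+nf_{n+1}(z)\ne0$, $$\pi_n''=\Big(\frac{\wp'}{f_n}+n\Big(\frac{f_{n+1}}{f_n}\Big)'\Big((n-1)+n\frac{f_{n+1}}{f_n}\Big)^{-1}\Big)\pi_n'+\Big(\Big(\frac{n\wp'}{2f_n}\Big)'-n\Big(\frac{f_{n+1}}{f_n}\Big)'\frac{n\wp'}{2\big((n-1)f_n+nf_{n+1}\big)}-\det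 L_n\Big)\pi_n .$$ -/

import Mathlib

open Filter Topology Asymptotics

noncomputable section

namespace EllipticOP

/-- The pair of periods `(1, τ)`, for `τ` in the upper half-plane. -/
def periods (τ : UpperHalfPlane) : PeriodPair where
  ω₁ := 1
  ω₂ := (τ : ℂ)
  indep := by
    rw [LinearIndependent.pair_iff]
    intro s t h
    have him := congrArg Complex.im h
    have hre := congrArg Complex.re h
    have hτ : (τ : ℂ).im ≠ 0 := τ.im_ne_zero
    simp only [Complex.real_smul, mul_one, Complex.add_im, Complex.ofReal_im, Complex.mul_im,
      Complex.ofReal_re, zero_mul, add_zero, zero_add, Complex.zero_im, mul_eq_zero, hτ,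
      or_false] at him
    subst him
    simpa using hre

/-- The lattice `ℤ + ℤ τ`, as a set of complex numbers. -/
def latticeSet (τ : UpperHalfPlane) : Set ℂ := ((periods τ).lattice : Set ℂ)

/-- The Weierstrass function `℘` with periods `1` and `τ`. -/
def wp (τ : UpperHalfPlane) (z : ℂ) : ℂ := (periods τ).weierstrassP z

/-- The `z`-derivative `℘'` of the Weierstrass function with periods `1` and `τ`. -/
def wp' (τ : UpperHalfPlane) (z : ℂ) : ℂ := (periods τ).derivWeierstrassP z

/-- The integral `∫_γ g(z) dz` over the segment `γ` from `τ/2` to `τ/2 + 1`. -/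
def gammaIntegral (τ : UpperHalfPlane) (g : ℂ → ℂ) : ℂ :=
  ∫ t in (0 : ℝ)..1, g ((τ : ℂ) / 2 + (t : ℂ))

/-- The basis functions `𝓔₂ₖ = ℘ᵏ` and `𝓔₂ₖ₊₃ = -½ ℘' ℘ᵏ`. The index `1` is never used. -/
def ellBasis (τ : UpperHalfPlane) (m : ℕ) (z : ℂ) : ℂ :=
  if Even m then wp τ z ^ (m / 2) else -(1 / 2) * wp' τ z * wp τ z ^ ((m - 3) / 2)

/-- The moments `μᵢⱼ = ∫_γ 𝓔ᵢ 𝓔ⱼ dz` for the weight `1`. -/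
def moment (τ : UpperHalfPlane) (i j : ℕ) : ℂ :=
  gammaIntegral τ (fun z => ellBasis τ i z * ellBasis τ j z)

/-- The increasing enumeration `0, 2, 3, 4, …` of the natural numbers different from `1`. -/
def idx (i : ℕ) : ℕ := if i = 0 then 0 else i + 1

/-- The determinant `Dₙ` of the moments `μᵢⱼ` with `i, j ∈ {0, 2, 3, …, n - 1}`. -/
def momentDet (τ : UpperHalfPlane) (n : ℕ) : ℂ :=
  (Matrix.of fun i j : Fin (n - 1) => moment τ (idx i) (idx j)).det

/-- `p` is a monic elliptic polynomial of degree `n`: an elliptic function with periods `1` and `τ`,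
all of whose poles lie on the lattice, with `p(z) = z⁻ⁿ (1 + O(z))` as `z → 0`.
(The values that Lean's total function `p` takes at lattice points are irrelevant.) -/
structure IsMonicEllipticPolynomial (τ : UpperHalfPlane) (n : ℕ) (p : ℂ → ℂ) : Prop where
  differentiableOn : DifferentiableOn ℂ p (latticeSet τ)ᶜ
  add_one : ∀ z ∉ latticeSet τ, p (z + 1) = p z
  add_tau : ∀ z ∉ latticeSet τ, p (z + (τ : ℂ)) = p z
  monic : (fun z : ℂ => z ^ n * p z - 1) =O[𝓝[≠] 0] (fun z : ℂ => z)

/-- `p` is the `n`-th elliptic orthogonal polynomial `πₙ` for the weight `1`: it is monic of degree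
`n` and orthogonal on `γ` to all elliptic polynomials of smaller degree. -/
structure IsEOP (τ : UpperHalfPlane) (n : ℕ) (p : ℂ → ℂ) : Prop
    extends IsMonicEllipticPolynomial τ n p where
  orthogonal : ∀ m < n, m ≠ 1 → gammaIntegral τ (fun z => p z * ellBasis τ m z) = 0

/-- The preimage in `ℂ` of the closed curve `γ` on the torus `ℂ / (ℤ + ℤ τ)`: the union of the
horizontal lines `ℝ + (k + 1/2) τ`, `k ∈ ℤ`. -/
def contour (τ : UpperHalfPlane) : Set ℂ :=
  {z | ∃ (t : ℝ) (k : ℤ), z = (t : ℂ) + ((k : ℂ) + 1 / 2) * (τ : ℂ)}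

/-- The preimage in `ℂ` of the torus with `γ` and `0` removed. -/
def domain (τ : UpperHalfPlane) : Set ℂ := (latticeSet τ ∪ contour τ)ᶜ

/-- `Y` solves the Riemann-Hilbert problem of index `n` with weight `1`. A function on the torus
minus `γ ∪ {0}` is written as a doubly periodic function on `domain τ`; `γ` is oriented
from `τ/2` to `τ/2 + 1`, so that its left side (`+`) is the upper one. -/
structure IsRHPSolution (τ : UpperHalfPlane) (n : ℕ) (Y : ℂ → Matrix (Fin 2) (Fin 2) ℂ) :
    Prop where
  analytic : ∀ i j, AnalyticOnNhd ℂ (fun z => Y z i j) (domain τ)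
  add_one : ∀ z ∈ domain τ, Y (z + 1) = Y z
  add_tau : ∀ z ∈ domain τ, Y (z + (τ : ℂ)) = Y z
  jump : ∀ t ∈ Set.Icc (0 : ℝ) 1, ∃ Yplus Yminus : Matrix (Fin 2) (Fin 2) ℂ,
    Tendsto Y (𝓝[{z : ℂ | (τ : ℂ).im / 2 < z.im}] ((τ : ℂ) / 2 + (t : ℂ))) (𝓝 Yplus) ∧
    Tendsto Y (𝓝[{z : ℂ | z.im < (τ : ℂ).im / 2}] ((τ : ℂ) / 2 + (t : ℂ))) (𝓝 Yminus) ∧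
    Yplus = Yminus * !![1, 1; 0, 1]
  /-- `Y(z) = (1 + O(z)) diag(z⁻ⁿ, zⁿ⁻²)` as `z → 0`. -/
  asymptotic : ∀ i j,
    (fun z : ℂ => (Y z * !![z ^ (n : ℤ), 0; 0, z ^ (2 - (n : ℤ))] - 1) i j)
      =O[𝓝[≠] 0] (fun z : ℂ => z)

/-- The matrix `Lₙ(z)`, for given values `fprev = fₙ₋₁(z)`, `f = fₙ(z)`, `fnext = fₙ₊₁(z)`,
`d = ℘'(z)`, `hprev = hₙ₋₁` and `h = hₙ`. -/
def laxMatrix (n : ℕ) (hprev h fprev f fnext d : ℂ) : Matrix (Fin 2) (Fin 2) ℂ :=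
  (1 / f) • !![(n : ℂ) * d / 2,
      h / (2 * Real.pi * Complex.I) * (((n : ℂ) - 1) * f + (n : ℂ) * fnext);
    2 * Real.pi * Complex.I / hprev * ((2 - (n : ℂ)) * fprev + (1 - (n : ℂ)) * f),
      (2 - (n : ℂ)) * d / 2]

end EllipticOP

end

/-!
Continuing a row `(r₀, r₁)` of `Yₙ` across `γ` from below trades the jump for quasi-periodicity:
`r₀` is elliptic, and `r₁` loses `r₀` under `z ↦ z + τ`. The determinant of two such rows is
therefore elliptic, and its leading terms at `0` pin it down. This gives `det Yₙ = ℘ + αₙ`.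

Integrating `r₁ e` around a period parallelogram, for an elliptic function `e`, identifies
`∫_γ r₀ e dz` with `2πi` times a residue at `0`. Hence the first entry of a row of degree `m` is
orthogonal to all elliptic polynomials of smaller degree, and `Dₘ ≠ 0` makes the row unique up to a
scalar. Three consequences follow: `πₙ` is the first entry of the first row of `Yₙ`, that row is
proportional to the second row of `Yₙ₊₁`, and rows of degree `m` have parity `(-1)ᵐ` under
`(r₀(z), r₁(z)) ↦ (r₀(-z), -r₁(-z))`.

Subtracting leading terms from the derivative of the first row of `Yₙ` leaves a multiple of that
row, which expresses the off-diagonal entries of `Lₙ`; parity excludes `℘` and constants from the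
diagonal ones. The differential equation for `πₙ` results from eliminating the second unknown of the
resulting system.
-/

namespace EllipticOP

section LeadingTerm

variable {𝕜 : Type*} [NontriviallyNormedField 𝕜] {g h : 𝕜 → 𝕜} {x : 𝕜} {k l : ℤ} {c d : 𝕜}

/-- `g` is meromorphic at `x`, with `g(z) = c (z - x)ᵏ (1 + O(z - x))` if `c ≠ 0`, and with order
greater than `k` if `c = 0`. Allowing `c = 0` makes the notion additive. -/
def HasLeadingTermAt (g : 𝕜 → 𝕜) (x : 𝕜) (k : ℤ) (c : 𝕜) : Prop :=
  ∃ φ : 𝕜 → 𝕜, AnalyticAt 𝕜 φ x ∧ φ x = c ∧ ∀ᶠ z in 𝓝[≠] x, g z = (z - x) ^ k * φ z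

theorem eventually_sub_ne_zero (x : 𝕜) : ∀ᶠ z in 𝓝[≠] x, z - x ≠ 0 :=
  eventually_mem_nhdsWithin.mono fun _ => sub_ne_zero.2

namespace HasLeadingTermAt

theorem congr (hg : HasLeadingTermAt g x k c) (hgh : h =ᶠ[𝓝[≠] x] g) :
    HasLeadingTermAt h x k c := by
  obtain ⟨φ, hφ, hφx, hgφ⟩ := hg
  exact ⟨φ, hφ, hφx, hgh.trans hgφ⟩

theorem of_eq (hg : HasLeadingTermAt g x k c) (hk : k = l) (hc : c = d) :
    HasLeadingTermAt g x l d :=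
  hk ▸ hc ▸ hg

theorem tendsto (hg : HasLeadingTermAt g x k c) :
    Tendsto (fun z => (z - x) ^ (-k) * g z) (𝓝[≠] x) (𝓝 c) := by
  obtain ⟨φ, hφ, rfl, hgφ⟩ := hg
  refine (hφ.continuousAt.tendsto.mono_left nhdsWithin_le_nhds).congr' ?_
  filter_upwards [hgφ, eventually_sub_ne_zero x] with z hz hzx
  rw [hz, zpow_neg, inv_mul_cancel_left₀ (zpow_ne_zero k hzx)]

theorem unique (hg : HasLeadingTermAt g x k c) (hg' : HasLeadingTermAt g x k d) : c = d :=
  tendsto_nhds_unique hg.tendsto hg'.tendsto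

theorem of_analyticAt (hg : AnalyticAt 𝕜 g x) : HasLeadingTermAt g x 0 (g x) :=
  ⟨g, hg, rfl, by simp⟩

theorem const (a : 𝕜) : HasLeadingTermAt (fun _ => a) x 0 a :=
  of_analyticAt analyticAt_const

theorem of_analyticAt_of_eq_zero (hg : AnalyticAt 𝕜 g x) (hgx : g x = 0) :
    HasLeadingTermAt g x 1 (deriv g x) := by
  obtain ⟨p, hp⟩ := hg
  refine ⟨dslope g x, ⟨_, hp.has_fpower_series_dslope_fslope⟩, dslope_same g x, .of_forall ?_⟩
  intro z
  rw [zpow_one, ← smul_eq_mul (z - x), sub_smul_dslope, hgx, sub_zero]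

theorem add (hg : HasLeadingTermAt g x k c) (hh : HasLeadingTermAt h x k d) :
    HasLeadingTermAt (fun z => g z + h z) x k (c + d) := by
  obtain ⟨φ, hφ, rfl, hgφ⟩ := hg
  obtain ⟨ψ, hψ, rfl, hhψ⟩ := hh
  refine ⟨φ + ψ, hφ.add hψ, rfl, ?_⟩
  filter_upwards [hgφ, hhψ] with z hgz hhz
  rw [hgz, hhz, Pi.add_apply, mul_add]

theorem mul (hg : HasLeadingTermAt g x k c) (hh : HasLeadingTermAt h x l d) :
    HasLeadingTermAt (fun z => g z * h z) x (k + l) (c * d) := by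
  obtain ⟨φ, hφ, rfl, hgφ⟩ := hg
  obtain ⟨ψ, hψ, rfl, hhψ⟩ := hh
  refine ⟨φ * ψ, hφ.mul hψ, rfl, ?_⟩
  filter_upwards [hgφ, hhψ, eventually_sub_ne_zero x] with z hgz hhz hzx
  rw [hgz, hhz, zpow_add₀ hzx, Pi.mul_apply, mul_mul_mul_comm]

theorem const_mul (hg : HasLeadingTermAt g x k c) (a : 𝕜) :
    HasLeadingTermAt (fun z => a * g z) x k (a * c) :=
  ((const a).mul hg).of_eq (zero_add k) rfl

theorem neg (hg : HasLeadingTermAt g x k c) : HasLeadingTermAt (fun z => -g z) x k (-c) := by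
  simpa only [neg_one_mul] using hg.const_mul (-1)

theorem sub (hg : HasLeadingTermAt g x k c) (hh : HasLeadingTermAt h x k d) :
    HasLeadingTermAt (fun z => g z - h z) x k (c - d) := by
  simpa only [sub_eq_add_neg] using hg.add hh.neg

theorem pow (hg : HasLeadingTermAt g x k c) (m : ℕ) :
    HasLeadingTermAt (fun z => g z ^ m) x (k * m) (c ^ m) := by
  induction m with
  | zero => simpa using const 1
  | succ m ih =>
    simp only [pow_succ]
    exact (ih.mul hg).of_eq (by push_cast; ring) rfl

theorem inv (hg : HasLeadingTermAt g x k c) (hc : c ≠ 0) :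
    HasLeadingTermAt (fun z => (g z)⁻¹) x (-k) c⁻¹ := by
  obtain ⟨φ, hφ, rfl, hgφ⟩ := hg
  refine ⟨φ⁻¹, hφ.inv hc, rfl, ?_⟩
  filter_upwards [hgφ] with z hz
  rw [hz, Pi.inv_apply, mul_inv, zpow_neg]

theorem exists_add_one (hg : HasLeadingTermAt g x k 0) :
    ∃ d, HasLeadingTermAt g x (k + 1) d := by
  obtain ⟨φ, hφ, hφx, hgφ⟩ := hg
  obtain ⟨ψ, hψ, -, hφψ⟩ := of_analyticAt_of_eq_zero hφ hφx
  refine ⟨ψ x, ψ, hψ, rfl, ?_⟩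
  filter_upwards [hgφ, hφψ, eventually_sub_ne_zero x] with z hz hz' hzx
  rw [hz, hz', zpow_one, zpow_add_one₀ hzx, mul_assoc]

theorem exists_sub (hg : HasLeadingTermAt g x k c) (hh : HasLeadingTermAt h x k c) :
    ∃ d, HasLeadingTermAt (fun z => g z - h z) x (k + 1) d :=
  ((hg.sub hh).of_eq rfl (sub_self c)).exists_add_one

theorem sub_one (hg : HasLeadingTermAt g x k c) : HasLeadingTermAt g x (k - 1) 0 := by
  obtain ⟨φ, hφ, -, hgφ⟩ := hg
  refine ⟨fun z => (z - x) * φ z, (analyticAt_id.sub analyticAt_const).mul hφ, by simp, ?_⟩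
  filter_upwards [hgφ, eventually_sub_ne_zero x] with z hz hzx
  rw [hz, zpow_sub_one₀ hzx, mul_assoc, inv_mul_cancel_left₀ hzx]

theorem of_lt (hg : HasLeadingTermAt g x l c) (hkl : k < l) : HasLeadingTermAt g x k 0 := by
  replace hkl : k + 1 ≤ l := hkl
  induction l, hkl using Int.leInduction generalizing c with
  | base => exact hg.sub_one.of_eq (add_sub_cancel_right k 1) rfl
  | succ l _ ih => exact ih (hg.sub_one.of_eq (add_sub_cancel_right l 1) rfl)

theorem deriv [CompleteSpace 𝕜] (hg : HasLeadingTermAt g x k c) :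
    HasLeadingTermAt (deriv g) x (k - 1) (k * c) := by
  obtain ⟨φ, hφ, rfl, hgφ⟩ := hg
  refine ⟨fun z => k * φ z + (z - x) * _root_.deriv φ z,
    (analyticAt_const.mul hφ).add ((analyticAt_id.sub analyticAt_const).mul hφ.deriv),
    by simp, ?_⟩
  have hgφ' : g =ᶠ[𝓝[≠] x] fun z => (z - x) ^ k * φ z := hgφ
  filter_upwards [hgφ'.nhdsNE_deriv, hφ.eventually_analyticAt.filter_mono nhdsWithin_le_nhds,
    eventually_sub_ne_zero x] with z hz hφz hzx
  have hpow : HasDerivAt (fun w => (w - x) ^ k) (k * (z - x) ^ (k - 1)) z :=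
    (hasDerivAt_zpow k (z - x) (.inl hzx)).comp_sub_const z x
  rw [hz, (hpow.fun_mul hφz.differentiableAt.hasDerivAt).deriv, zpow_sub_one₀ hzx]
  field_simp

theorem comp_neg (hg : HasLeadingTermAt g (-x) k c) :
    HasLeadingTermAt (fun z => g (-z)) x k ((-1) ^ k * c) := by
  obtain ⟨φ, hφ, rfl, hgφ⟩ := hg
  refine ⟨fun z => (-1) ^ k * φ (-z), analyticAt_const.mul (hφ.comp analyticAt_id.neg), rfl, ?_⟩
  have hneg : Tendsto (fun z : 𝕜 => -z) (𝓝[≠] x) (𝓝[≠] (-x)) :=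
    continuous_neg.continuousAt.continuousWithinAt.tendsto_nhdsWithin fun _ => neg_inj.not.2
  filter_upwards [hneg.eventually hgφ] with z hz
  rw [hz, neg_sub_neg, ← neg_sub, neg_eq_neg_one_mul, mul_zpow, mul_assoc, mul_left_comm]

theorem of_tendsto {g : ℂ → ℂ} {x c : ℂ} (hd : ∀ᶠ z in 𝓝[≠] x, DifferentiableAt ℂ g z)
    (ht : Tendsto (fun z => (z - x) ^ (-k) * g z) (𝓝[≠] x) (𝓝 c)) :
    HasLeadingTermAt g x k c := by
  refine ⟨Function.update (fun z => (z - x) ^ (-k) * g z) x c,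
    Complex.analyticAt_of_differentiable_on_punctured_nhds_of_continuousAt ?_
      (continuousAt_update_same.2 ht), Function.update_self .., ?_⟩
  · filter_upwards [hd, self_mem_nhdsWithin] with z hz (hzx : z ≠ x)
    have hpow : DifferentiableAt ℂ (fun w => (w - x) ^ (-k)) z :=
      (differentiableAt_id.sub_const x).zpow (.inl (sub_ne_zero.2 hzx))
    exact (hpow.mul hz).congr_of_eventuallyEq
      ((eventually_ne_nhds hzx).mono fun w hw => Function.update_of_ne hw ..)
  · filter_upwards [self_mem_nhdsWithin] with z (hzx : z ≠ x)
    rw [Function.update_of_ne hzx, zpow_neg,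
      mul_inv_cancel_left₀ (zpow_ne_zero k (sub_ne_zero.2 hzx))]

theorem of_isBigO {g : ℂ → ℂ} {x c : ℂ} (hd : ∀ᶠ z in 𝓝[≠] x, DifferentiableAt ℂ g z)
    (ho : (fun z => (z - x) ^ (-k) * g z - c) =O[𝓝[≠] x] (fun z => z - x)) :
    HasLeadingTermAt g x k c := by
  refine of_tendsto hd (tendsto_sub_nhds_zero_iff.1 (ho.trans_tendsto ?_))
  exact (continuous_sub_right x).tendsto' x 0 (sub_self x) |>.mono_left nhdsWithin_le_nhds

end HasLeadingTermAt

end LeadingTerm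

section Elliptic

variable {L : PeriodPair} {g h : ℂ → ℂ} {z ω c : ℂ}

theorem isOpen_compl_lattice (L : PeriodPair) : IsOpen ((L.lattice : Set ℂ)ᶜ) :=
  L.isClosed_lattice.isOpen_compl

theorem eventually_notMem_lattice (L : PeriodPair) (x : ℂ) : ∀ᶠ z in 𝓝[≠] x, z ∉ L.lattice := by
  rw [eventually_nhdsWithin_iff]
  filter_upwards [L.compl_lattice_sdiff_singleton_mem_nhds x] with z hz hzx hzL
  exact hz ⟨hzL, hzx⟩

theorem eventually_differentiableAt (hg : DifferentiableOn ℂ g (L.lattice : Set ℂ)ᶜ) (x : ℂ) :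
    ∀ᶠ z in 𝓝[≠] x, DifferentiableAt ℂ g z :=
  (eventually_notMem_lattice L x).mono fun _ hz =>
    hg.differentiableAt ((isOpen_compl_lattice L).mem_nhds hz)

theorem apply_add_of_mem_lattice {X : Type*} {f : ℂ → X} {S : Set ℂ}
    (hS : ∀ ω ∈ L.lattice, ∀ z ∈ S, z + ω ∈ S) (h₁ : ∀ z ∈ S, f (z + L.ω₁) = f z)
    (h₂ : ∀ z ∈ S, f (z + L.ω₂) = f z) (hω : ω ∈ L.lattice) : ∀ z ∈ S, f (z + ω) = f z := by
  induction hω using Submodule.span_induction with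
  | mem ω hω => rcases hω with rfl | rfl <;> assumption
  | zero => simp
  | add ω _ hω _ ih ih' =>
    intro z hz
    rw [← add_assoc, ih' _ (hS ω hω z hz), ih z hz]
  | smul n ω hω ih =>
    induction n with
    | zero => simp
    | succ n ihn =>
      intro z hz
      rw [add_smul, one_smul, ← add_assoc, ih _ (hS _ (L.lattice.smul_mem _ hω) z hz), ihn z hz]
    | pred n ihn =>
      intro z hz
      have hz' := hS _ (L.lattice.smul_mem (-(n : ℤ) - 1) hω) z hz
      rw [← ih _ hz', add_assoc, sub_smul, one_smul, sub_add_cancel, ihn z hz]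

theorem deriv_apply_add_of_notMem_lattice (hgh : ∀ z ∉ L.lattice, g (z + ω) = h z)
    (hz : z ∉ L.lattice) : deriv g (z + ω) = deriv h z := by
  rw [← deriv_comp_add_const]
  apply Filter.EventuallyEq.deriv_eq
  filter_upwards [(isOpen_compl_lattice L).mem_nhds hz] using hgh

/-- An elliptic function for the lattice of `L` all of whose poles lie on that lattice. Its values
at lattice points are irrelevant, and no behaviour at the poles is prescribed. -/
structure IsElliptic (L : PeriodPair) (g : ℂ → ℂ) : Prop where
  differentiableOn : DifferentiableOn ℂ g (L.lattice : Set ℂ)ᶜ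
  add_lattice : ∀ ω ∈ L.lattice, ∀ z ∉ L.lattice, g (z + ω) = g z

namespace IsElliptic

theorem of_add_periods (hg : DifferentiableOn ℂ g (L.lattice : Set ℂ)ᶜ)
    (h₁ : ∀ z ∉ L.lattice, g (z + L.ω₁) = g z) (h₂ : ∀ z ∉ L.lattice, g (z + L.ω₂) = g z) :
    IsElliptic L g where
  differentiableOn := hg
  add_lattice _ hω := apply_add_of_mem_lattice (S := (L.lattice : Set ℂ)ᶜ)
    (fun _ hω _ => (L.lattice.add_mem_iff_left hω).not.2) h₁ h₂ hω

theorem differentiableAt (hg : IsElliptic L g) (hz : z ∉ L.lattice) : DifferentiableAt ℂ g z :=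
  hg.differentiableOn.differentiableAt ((isOpen_compl_lattice L).mem_nhds hz)

theorem congr (hg : IsElliptic L g) (hgh : ∀ z ∉ L.lattice, h z = g z) : IsElliptic L h where
  differentiableOn := hg.1.congr hgh
  add_lattice ω hω z hz := by
    rw [hgh z hz, hgh _ ((L.lattice.add_mem_iff_left hω).not.2 hz), hg.2 ω hω z hz]

theorem const (c : ℂ) : IsElliptic L (fun _ => c) :=
  ⟨differentiableOn_const c, fun _ _ _ _ => rfl⟩

theorem sub (hg : IsElliptic L g) (hh : IsElliptic L h) : IsElliptic L (fun z => g z - h z) :=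
  ⟨hg.1.sub hh.1, fun ω hω z hz => by rw [hg.2 ω hω z hz, hh.2 ω hω z hz]⟩

theorem mul (hg : IsElliptic L g) (hh : IsElliptic L h) : IsElliptic L (fun z => g z * h z) :=
  ⟨hg.1.mul hh.1, fun ω hω z hz => by rw [hg.2 ω hω z hz, hh.2 ω hω z hz]⟩

theorem const_mul (hg : IsElliptic L g) (c : ℂ) : IsElliptic L (fun z => c * g z) :=
  (const c).mul hg

theorem pow (hg : IsElliptic L g) (m : ℕ) : IsElliptic L (fun z => g z ^ m) :=
  ⟨hg.1.pow m, fun ω hω z hz => by rw [hg.2 ω hω z hz]⟩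

theorem comp_neg (hg : IsElliptic L g) : IsElliptic L (fun z => g (-z)) where
  differentiableOn := hg.1.comp differentiable_neg.differentiableOn
    fun _ => L.lattice.neg_mem_iff.not.2
  add_lattice ω hω z hz := by
    rw [neg_add, hg.2 _ (neg_mem hω) _ (L.lattice.neg_mem_iff.not.2 hz)]

theorem deriv (hg : IsElliptic L g) : IsElliptic L (deriv g) :=
  ⟨hg.1.deriv (isOpen_compl_lattice L),
    fun ω hω _ => deriv_apply_add_of_notMem_lattice (hg.2 ω hω)⟩

theorem eq_const (hg : IsElliptic L g) (h0 : HasLeadingTermAt g 0 0 c) (hz : z ∉ L.lattice) :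
    g z = c := by
  classical
  let G := (L.lattice : Set ℂ).piecewise (fun _ => c) g
  have hGadd (z ω : ℂ) (hω : ω ∈ L.lattice) : G (z + ω) = G z := by
    by_cases hz : z ∈ L.lattice
    · simp [G, hz, add_mem hz hω]
    · simp [G, hz, L.lattice.add_mem_iff_left hω, hg.2 ω hω z hz]
  have hG0 : DifferentiableAt ℂ G 0 := by
    obtain ⟨φ, hφ, rfl, hgφ⟩ := h0
    refine hφ.differentiableAt.congr_of_eventuallyEq
      (eventuallyEq_nhds_of_eventuallyEq_nhdsNE ?_ (by simp [G]))
    filter_upwards [hgφ, eventually_notMem_lattice L 0] with z hgz hz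
    simpa [G, hz] using hgz
  have hG : Differentiable ℂ G := by
    intro z
    by_cases hz : z ∈ L.lattice
    · have hGz : (fun w => G (w - z)) = G := by
        ext w
        rw [← hGadd _ z hz, sub_add_cancel]
      rw [← hGz]
      exact differentiableAt_comp_sub_const.2 (by rwa [sub_self])
    · refine (hg.differentiableAt hz).congr_of_eventuallyEq ?_
      filter_upwards [(isOpen_compl_lattice L).mem_nhds hz] with w hw
      exact Set.piecewise_eq_of_notMem _ _ _ hw
  have hbdd := (IsZLattice.isCompact_range_of_periodic L.lattice G hG.continuous hGadd).isBounded
  simpa [G, hz] using hG.apply_eq_apply_of_bounded hbdd z 0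

end IsElliptic

open scoped PeriodPair

theorem isElliptic_weierstrassP (L : PeriodPair) : IsElliptic L ℘[L] :=
  ⟨L.differentiableOn_weierstrassP, fun ω hω z _ => L.weierstrassP_add_coe z ⟨ω, hω⟩⟩

theorem isElliptic_derivWeierstrassP (L : PeriodPair) : IsElliptic L ℘'[L] :=
  L.deriv_weierstrassP ▸ (isElliptic_weierstrassP L).deriv

theorem hasLeadingTermAt_weierstrassP (L : PeriodPair) : HasLeadingTermAt ℘[L] 0 (-2) 1 := by
  refine ⟨fun z => 1 + z ^ 2 * L.weierstrassPExcept 0 z, analyticAt_const.add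
    ((analyticAt_id.pow 2).mul (L.analyticAt_weierstrassPExcept 0)), by simp, ?_⟩
  filter_upwards [self_mem_nhdsWithin] with z (hz : z ≠ 0)
  have hsum := L.weierstrassPExcept_add 0 z
  simp only [ZeroMemClass.coe_zero, sub_zero] at hsum
  rw [← hsum, sub_zero, zpow_neg, zpow_ofNat]
  field_simp
  ring

theorem hasLeadingTermAt_derivWeierstrassP (L : PeriodPair) :
    HasLeadingTermAt ℘'[L] 0 (-3) (-2) := by
  rw [← L.deriv_weierstrassP]
  exact (hasLeadingTermAt_weierstrassP L).deriv.of_eq (by norm_num) (by norm_num)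

end Elliptic

section Residue

open Complex

variable {g : ℂ → ℂ} {c : ℂ} {y : ℝ}

theorem integral_comp_cexp_two_pi_mul_I {E : Type*} [NormedAddCommGroup E] [NormedSpace ℂ E]
    [CompleteSpace E] {f : ℂ → E}
    (hf : DiffContOnCl ℂ f (Metric.ball 0 (Real.exp (-(2 * Real.pi * y))))) (a : ℝ) :
    ∫ x in a..a + 1, f (cexp (2 * Real.pi * I * (x + y * I))) = f 0 := by
  set R := Real.exp (-(2 * Real.pi * y)) with hR
  have hcircle (x : ℝ) :
      cexp (2 * Real.pi * I * (x + y * I)) = circleMap 0 R (2 * Real.pi * x) := by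
    rw [circleMap_zero, hR, ofReal_exp, ← Complex.exp_add]
    congr 1
    push_cast
    linear_combination (2 * Real.pi * y : ℂ) * I_mul_I
  have hmean : Real.circleAverage f 0 R = f 0 :=
    DiffContOnCl.circleAverage (by rwa [abs_of_pos (Real.exp_pos _)])
  have hper : Function.Periodic (fun x : ℝ => f (circleMap 0 R (2 * Real.pi * x))) 1 := fun x => by
    simp only [mul_add, mul_one, periodic_circleMap 0 R _]
  simp_rw [hcircle]
  rw [hper.intervalIntegral_add_eq a 0, zero_add,
    intervalIntegral.integral_comp_mul_left (fun θ => f (circleMap 0 R θ)) Real.two_pi_pos.ne',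
    mul_zero, mul_one, ← hmean, Real.circleAverage_def]

/-- The kernel `π cot (π z)` of period `1`, with simple poles of residue `1` at the integers. -/
noncomputable def cotKernel (z : ℂ) : ℂ := Real.pi * cot (Real.pi * z)

theorem cotKernel_add_one (z : ℂ) : cotKernel (z + 1) = cotKernel z := by
  simp only [cotKernel, cot, mul_add, mul_one, cos_add_pi, sin_add_pi, neg_div_neg_eq]

theorem cotKernel_neg (z : ℂ) : cotKernel (-z) = -cotKernel z := by
  simp only [cotKernel, cot, mul_neg, Complex.cos_neg, Complex.sin_neg, div_neg]

theorem differentiableAt_cotKernel {z : ℂ} (hz : z ∈ integerComplement) :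
    DifferentiableAt ℂ cotKernel z := by
  unfold cotKernel cot
  have := sin_pi_mul_ne_zero hz
  fun_prop (disch := assumption)

theorem mem_integerComplement_of_abs_re_le {z : ℂ} (hre : |z.re| ≤ 1 / 2) (hz : z ≠ 0) :
    z ∈ integerComplement := by
  rintro ⟨n, rfl⟩
  have hn : |(n : ℝ)| < 1 := lt_of_le_of_lt (by simpa using hre) one_half_lt_one
  exact hz (by simpa using Int.abs_lt_one_iff.1 (by exact_mod_cast hn))

theorem hasLeadingTermAt_cotKernel : HasLeadingTermAt cotKernel 0 (-1) 1 := by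
  have hpi : (Real.pi : ℂ) ≠ 0 := ofReal_ne_zero.2 Real.pi_ne_zero
  have hsin : HasDerivAt (fun z : ℂ => sin (Real.pi * z)) Real.pi 0 := by
    simpa using ((hasDerivAt_id (0 : ℂ)).const_mul (Real.pi : ℂ)).csin
  have hcos : HasLeadingTermAt (fun z : ℂ => cos (Real.pi * z)) 0 0 1 :=
    (HasLeadingTermAt.of_analyticAt (by fun_prop)).of_eq rfl (by simp)
  have hsin' : HasLeadingTermAt (fun z : ℂ => sin (Real.pi * z)) 0 1 Real.pi :=
    (HasLeadingTermAt.of_analyticAt_of_eq_zero (by fun_prop) (by simp)).of_eq rfl hsin.deriv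
  exact ((hcos.mul (hsin'.inv hpi)).const_mul _).of_eq rfl (by field_simp)

theorem integral_cotKernel_of_pos (hy : 0 < y) (a : ℝ) :
    ∫ x in a..a + 1, cotKernel (x + y * I) = -(Real.pi * I) := by
  have hR : Real.exp (-(2 * Real.pi * y)) < 1 :=
    Real.exp_lt_one_iff.2 (neg_neg_of_pos (by positivity))
  let f (q : ℂ) : ℂ := Real.pi * ((q + 1) / (I * (1 - q)))
  have hf : DiffContOnCl ℂ f (Metric.ball 0 (Real.exp (-(2 * Real.pi * y)))) := by
    refine DifferentiableOn.diffContOnCl fun q hq =>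
      DifferentiableAt.differentiableWithinAt (𝕜 := ℂ) ?_
    have hq1 : q ≠ 1 := by
      rintro rfl
      have := Metric.closure_ball_subset_closedBall hq
      rw [mem_closedBall_zero_iff, norm_one] at this
      exact hR.not_ge this
    have := mul_ne_zero I_ne_zero (sub_ne_zero.2 hq1.symm)
    fun_prop (disch := assumption)
  simp_rw [cotKernel, cot_pi_eq_exp_ratio]
  rw [integral_comp_cexp_two_pi_mul_I hf a]
  simp [f]

theorem integral_cotKernel_of_neg (hy : 0 < y) :
    ∫ x in (-1 / 2 : ℝ)..1 / 2, cotKernel (x + (-y : ℝ) * I) = Real.pi * I := by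
  have hodd (x : ℝ) : cotKernel (x + (-y : ℝ) * I) = -cotKernel ((-x : ℝ) + y * I) := by
    rw [← cotKernel_neg]
    push_cast
    ring_nf
  simp_rw [hodd]
  rw [intervalIntegral.integral_neg,
    intervalIntegral.integral_comp_neg (fun x : ℝ => cotKernel (x + y * I))]
  have := integral_cotKernel_of_pos hy (-1 / 2)
  norm_num at this ⊢
  rw [this, neg_neg]

theorem integral_eq_of_hasLeadingTermAt_zero
    (hg : ∀ z : ℂ, |z.re| ≤ 1 / 2 → |z.im| ≤ y → z ≠ 0 → DifferentiableAt ℂ g z)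
    (hper : ∀ t : ℝ, |t| ≤ y → g (-1 / 2 + t * I + 1) = g (-1 / 2 + t * I))
    (h0 : HasLeadingTermAt g 0 0 c) (hy : 0 < y) :
    ∫ x in (-1 / 2 : ℝ)..1 / 2, g (x + (-y : ℝ) * I) =
      ∫ x in (-1 / 2 : ℝ)..1 / 2, g (x + y * I) := by
  let G := Function.update g 0 c
  have hG (z : ℂ) (hz : z ≠ 0) : G z = g z := Function.update_of_ne hz c g
  have hGdiff : ∀ z : ℂ, |z.re| ≤ 1 / 2 → |z.im| ≤ y → DifferentiableAt ℂ G z := by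
    intro z hre him
    obtain rfl | hz := eq_or_ne z 0
    · obtain ⟨φ, hφ, rfl, hgφ⟩ := h0
      refine hφ.differentiableAt.congr_of_eventuallyEq
        (eventuallyEq_nhds_of_eventuallyEq_nhdsNE ?_ (Function.update_self ..))
      filter_upwards [hgφ, self_mem_nhdsWithin] with z hz (hz0 : z ≠ 0)
      rw [hG z hz0, hz, zpow_zero, one_mul]
    · exact (hg z hre him hz).congr_of_eventuallyEq ((eventually_ne_nhds hz).mono hG)
  have hrect := integral_boundary_rect_eq_zero_of_differentiableOn G
    (⟨-1 / 2, -y⟩ : ℂ) (⟨1 / 2, y⟩ : ℂ) fun z hz => by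
      rw [mem_reProdIm, Set.uIcc_of_le (by norm_num), Set.uIcc_of_le (by linarith)] at hz
      refine (hGdiff z (abs_le.2 ⟨?_, hz.1.2⟩) (abs_le.2 hz.2)).differentiableWithinAt
      linarith [hz.1.1]
  have hsides : ∫ t in (-y)..y, G ((1 / 2 : ℝ) + t * I) =
      ∫ t in (-y)..y, G ((-1 / 2 : ℝ) + t * I) := by
    refine intervalIntegral.integral_congr fun t ht => ?_
    have hre (s : ℝ) (hs : s ≠ 0) : (s + t * I : ℂ) ≠ 0 :=
      fun h => hs (by simpa using congrArg re h)
    rw [Set.uIcc_of_le (by linarith)] at ht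
    change G ((1 / 2 : ℝ) + t * I) = G ((-1 / 2 : ℝ) + t * I)
    rw [hG _ (hre _ (by norm_num)), hG _ (hre _ (by norm_num))]
    convert hper t (abs_le.2 ht) using 2 <;> push_cast <;> ring
  have hhor (x t : ℝ) (ht : t ≠ 0) : G (x + t * I) = g (x + t * I) :=
    hG _ fun h => ht (by simpa using congrArg im h)
  simpa only [hsides, add_sub_cancel_right, sub_eq_zero, hhor _ _ hy.ne',
    hhor _ _ (neg_ne_zero.2 hy.ne')] using hrect

theorem intervalIntegrable_horizontal {t : ℝ}
    (hg : ∀ z : ℂ, |z.re| ≤ 1 / 2 → |z.im| ≤ y → z ≠ 0 → DifferentiableAt ℂ g z)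
    (hty : |t| ≤ y) (ht : t ≠ 0) :
    IntervalIntegrable (fun x : ℝ => g (x + t * I)) MeasureTheory.volume (-1 / 2) (1 / 2) := by
  refine ContinuousOn.intervalIntegrable fun x hx => ContinuousAt.continuousWithinAt ?_
  rw [Set.uIcc_of_le (by norm_num)] at hx
  have hgx : DifferentiableAt ℂ g (x + t * I) := by
    refine hg _ ?_ (by simpa using hty) fun h => ht (by simpa using congrArg im h)
    simpa using abs_le.2 ⟨by linarith [hx.1], hx.2⟩
  exact hgx.continuousAt.comp' (f := fun x : ℝ => (x + t * I : ℂ)) (by fun_prop)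

theorem integral_sub_integral_eq_residue
    (hg : ∀ z : ℂ, |z.re| ≤ 1 / 2 → |z.im| ≤ y → z ≠ 0 → DifferentiableAt ℂ g z)
    (hper : ∀ t : ℝ, |t| ≤ y → g (-1 / 2 + t * I + 1) = g (-1 / 2 + t * I))
    (hc : HasLeadingTermAt g 0 (-1) c) (hy : 0 < y) :
    (∫ x in (-1 / 2 : ℝ)..1 / 2, g (x + (-y : ℝ) * I)) -
      ∫ x in (-1 / 2 : ℝ)..1 / 2, g (x + y * I) = 2 * Real.pi * I * c := by
  obtain ⟨d, hd⟩ := hc.exists_sub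
    ((hasLeadingTermAt_cotKernel.const_mul c).of_eq rfl (mul_one c))
  have hcot : ∀ z : ℂ, |z.re| ≤ 1 / 2 → |z.im| ≤ y → z ≠ 0 →
      DifferentiableAt ℂ (fun z => c * cotKernel z) z := fun z hre _ hz =>
    (differentiableAt_cotKernel (mem_integerComplement_of_abs_re_le hre hz)).const_mul c
  have hregular := integral_eq_of_hasLeadingTermAt_zero (g := fun z => g z - c * cotKernel z)
    (fun z hre him hz => (hg z hre him hz).sub (hcot z hre him hz))
    (fun t ht => by rw [hper t ht, cotKernel_add_one]) hd hy
  have hpos := integral_cotKernel_of_pos hy (-1 / 2)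
  rw [show (-1 / 2 + 1 : ℝ) = 1 / 2 by norm_num] at hpos
  have hlower : |-y| ≤ y := by rw [abs_neg, abs_of_pos hy]
  have hupper : |y| ≤ y := (abs_of_pos hy).le
  have hy0 := neg_ne_zero.2 hy.ne'
  rw [intervalIntegral.integral_sub (intervalIntegrable_horizontal hg hlower hy0)
      (intervalIntegrable_horizontal hcot hlower hy0),
    intervalIntegral.integral_sub (intervalIntegrable_horizontal hg hupper hy.ne')
      (intervalIntegrable_horizontal hcot hupper hy.ne'),
    intervalIntegral.integral_const_mul, intervalIntegral.integral_const_mul,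
    integral_cotKernel_of_neg hy, hpos] at hregular
  linear_combination hregular

end Residue

section GammaIntegral

open Complex

variable {τ : UpperHalfPlane} {g h : ℂ → ℂ} {z c : ℂ}

theorem mem_lattice_periods : z ∈ (periods τ).lattice ↔ ∃ m n : ℤ, z = m + n * τ := by
  simp [PeriodPair.mem_lattice, periods, eq_comm]

theorem one_mem_lattice (τ : UpperHalfPlane) : 1 ∈ (periods τ).lattice :=
  (periods τ).ω₁_mem_lattice

theorem tau_mem_lattice (τ : UpperHalfPlane) : (τ : ℂ) ∈ (periods τ).lattice :=
  (periods τ).ω₂_mem_lattice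

theorem notMem_lattice_of_abs_im_lt (h0 : z.im ≠ 0) (hz : |z.im| < τ.im) :
    z ∉ (periods τ).lattice := by
  rw [mem_lattice_periods]
  rintro ⟨m, n, rfl⟩
  have him : ((m : ℂ) + n * τ).im = n * τ.im := by simp
  rw [him, abs_mul, abs_of_pos τ.im_pos, mul_lt_iff_lt_one_left τ.im_pos] at hz
  have hn : n = 0 := Int.abs_lt_one_iff.1 (by exact_mod_cast hz)
  simp [hn] at h0

theorem notMem_lattice_of_abs_re_le (hre : |z.re| ≤ 1 / 2) (him : |z.im| < τ.im) (hz : z ≠ 0) :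
    z ∉ (periods τ).lattice := by
  by_cases h0 : z.im = 0
  · rw [mem_lattice_periods]
    rintro ⟨m, n, rfl⟩
    have hn : n = 0 := by simpa [τ.im_ne_zero] using h0
    subst hn
    have hm : m = 0 := Int.abs_lt_one_iff.1 (by
      have : |(m : ℝ)| < 1 := lt_of_le_of_lt (by simpa using hre) (by norm_num)
      exact_mod_cast this)
    simp [hm] at hz
  · exact notMem_lattice_of_abs_im_lt h0 him

theorem half_tau_add_notMem_lattice (τ : UpperHalfPlane) (t : ℝ) :
    (τ : ℂ) / 2 + t ∉ (periods τ).lattice :=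
  have him : ((τ : ℂ) / 2 + t).im = τ.im / 2 := by simp
  have hτ := τ.im_pos
  notMem_lattice_of_abs_im_lt (by rw [him]; positivity)
    (by rw [him, abs_of_pos (by positivity)]; linarith)

theorem integral_add_ofReal_eq_integral_horizontal {w : ℂ}
    (hg : ∀ t : ℝ, g (t + w.im * I + 1) = g (t + w.im * I)) :
    ∫ t in (0 : ℝ)..1, g (w + t) = ∫ x in (-1 / 2 : ℝ)..1 / 2, g (x + w.im * I) := by
  let F : ℝ → ℂ := fun x => g (x + w.im * I)
  have hF : Function.Periodic F 1 := fun x => by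
    simpa only [F, ofReal_add, ofReal_one, add_right_comm _ (1 : ℂ)] using hg x
  calc ∫ t in (0 : ℝ)..1, g (w + t) = ∫ t in (0 : ℝ)..1, F (w.re + t) := by
        refine intervalIntegral.integral_congr fun t _ => congrArg g ?_
        apply Complex.ext <;> simp
    _ = ∫ x in w.re..w.re + 1, F x := by
        rw [intervalIntegral.integral_comp_add_left, add_zero]
    _ = ∫ x in (-1 / 2 : ℝ)..1 / 2, F x := by
        rw [hF.intervalIntegral_add_eq w.re (-1 / 2)]
        norm_num

theorem gammaIntegral_sub_eq_residue (hg : DifferentiableOn ℂ g ((periods τ).lattice : Set ℂ)ᶜ)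
    (hper : ∀ z ∉ (periods τ).lattice, g (z + 1) = g z) (hc : HasLeadingTermAt g 0 (-1) c) :
    gammaIntegral τ (fun z => g (z - τ)) - gammaIntegral τ g = 2 * Real.pi * I * c := by
  have hτ := τ.im_pos
  have hline {y : ℝ} (hy : |y| = τ.im / 2) (t : ℝ) : g (t + y * I + 1) = g (t + y * I) := by
    refine hper _ (notMem_lattice_of_abs_im_lt ?_ ?_)
    · simpa using abs_pos.1 (hy ▸ half_pos hτ)
    · simpa [hy] using hτ
  have hlow : ((τ : ℂ) / 2 - τ).im = -(τ.im / 2) := by simp; ring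
  have hhigh : ((τ : ℂ) / 2).im = τ.im / 2 := by simp
  have habs : |τ.im / 2| = τ.im / 2 := abs_of_pos (half_pos hτ)
  rw [← integral_sub_integral_eq_residue (y := τ.im / 2) (fun z hre him hz => ?_)
    (fun t ht => hper _ ?_) hc (half_pos hτ)]
  · congr 1
    · simp only [gammaIntegral, add_sub_right_comm]
      rw [integral_add_ofReal_eq_integral_horizontal, hlow]
      rw [hlow]
      exact hline (by rw [abs_neg, habs])
    · rw [gammaIntegral, integral_add_ofReal_eq_integral_horizontal, hhigh]
      rw [hhigh]
      exact hline habs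
  · exact hg.differentiableAt ((isOpen_compl_lattice _).mem_nhds
      (notMem_lattice_of_abs_re_le hre (him.trans_lt (half_lt_self hτ)) hz))
  · refine notMem_lattice_of_abs_re_le (by simp; norm_num) ?_ fun h => ?_
    · simpa using ht.trans_lt (half_lt_self hτ)
    · simpa using congrArg re h

theorem gammaIntegral_congr (hgh : ∀ z ∉ (periods τ).lattice, g z = h z) :
    gammaIntegral τ g = gammaIntegral τ h :=
  intervalIntegral.integral_congr fun t _ => hgh _ (half_tau_add_notMem_lattice τ t)

theorem intervalIntegrable_gamma (hg : DifferentiableOn ℂ g ((periods τ).lattice : Set ℂ)ᶜ) :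
    IntervalIntegrable (fun t : ℝ => g ((τ : ℂ) / 2 + t)) MeasureTheory.volume 0 1 :=
  (hg.continuousOn.comp_continuous (by fun_prop)
    (half_tau_add_notMem_lattice τ)).intervalIntegrable _ _

theorem gammaIntegral_sub (hg : DifferentiableOn ℂ g ((periods τ).lattice : Set ℂ)ᶜ)
    (hh : DifferentiableOn ℂ h ((periods τ).lattice : Set ℂ)ᶜ) :
    gammaIntegral τ (fun z => g z - h z) = gammaIntegral τ g - gammaIntegral τ h :=
  intervalIntegral.integral_sub (intervalIntegrable_gamma hg) (intervalIntegrable_gamma hh)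

theorem gammaIntegral_const_mul (c : ℂ) (g : ℂ → ℂ) :
    gammaIntegral τ (fun z => c * g z) = c * gammaIntegral τ g :=
  intervalIntegral.integral_const_mul _ _

theorem gammaIntegral_sum {ι : Type*} (s : Finset ι) {f : ι → ℂ → ℂ}
    (hf : ∀ i ∈ s, DifferentiableOn ℂ (f i) ((periods τ).lattice : Set ℂ)ᶜ) :
    gammaIntegral τ (fun z => ∑ i ∈ s, f i z) = ∑ i ∈ s, gammaIntegral τ (f i) :=
  intervalIntegral.integral_finsetSum fun i hi => intervalIntegrable_gamma (hf i hi)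

end GammaIntegral

section MomentDet

variable {τ : UpperHalfPlane} {g : ℂ → ℂ} {c : ℂ}

namespace IsElliptic

theorem leadingCoeff_neg_one_eq_zero (hg : IsElliptic (periods τ) g)
    (hc : HasLeadingTermAt g 0 (-1) c) : c = 0 := by
  have hres := gammaIntegral_sub_eq_residue hg.1 (hg.2 1 (one_mem_lattice τ)) hc
  have hshift : gammaIntegral τ (fun z => g (z - τ)) = gammaIntegral τ g :=
    gammaIntegral_congr fun z hz => by
      rw [← hg.2 τ (tau_mem_lattice τ) (z - τ), sub_add_cancel]
      exact ((periods τ).lattice.sub_mem_iff_left (tau_mem_lattice τ)).not.2 hz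
  rw [hshift, sub_self, eq_comm, mul_eq_zero] at hres
  exact hres.resolve_left Complex.two_pi_I_ne_zero

theorem exists_eq_const (hg : IsElliptic (periods τ) g) (hc : HasLeadingTermAt g 0 (-1) c) :
    ∃ d, ∀ z ∉ (periods τ).lattice, g z = d := by
  obtain rfl := hg.leadingCoeff_neg_one_eq_zero hc
  obtain ⟨d, hd⟩ := hc.exists_add_one
  exact ⟨d, fun z => hg.eq_const hd⟩

end IsElliptic

theorem isElliptic_ellBasis (τ : UpperHalfPlane) (m : ℕ) :
    IsElliptic (periods τ) (ellBasis τ m) := by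
  unfold ellBasis
  split_ifs
  · exact (isElliptic_weierstrassP (periods τ)).pow _
  · exact ((isElliptic_derivWeierstrassP _).const_mul _).mul ((isElliptic_weierstrassP _).pow _)

theorem hasLeadingTermAt_ellBasis (τ : UpperHalfPlane) {m : ℕ} (hm : m ≠ 1) :
    HasLeadingTermAt (ellBasis τ m) 0 (-m) 1 := by
  unfold ellBasis
  split_ifs with heven
  · exact ((hasLeadingTermAt_weierstrassP (periods τ)).pow (m / 2)).of_eq (by grind) (one_pow _)
  · exact (((hasLeadingTermAt_derivWeierstrassP (periods τ)).const_mul (-(1 / 2))).mul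
      ((hasLeadingTermAt_weierstrassP _).pow ((m - 3) / 2))).of_eq (by grind) (by norm_num)

theorem IsElliptic.exists_eq_sum {m : ℕ} (hm : 1 ≤ m) (hg : IsElliptic (periods τ) g)
    (hc : HasLeadingTermAt g 0 (-m) c) : ∃ v : ℕ → ℂ, ∀ z ∉ (periods τ).lattice,
      g z = ∑ i ∈ Finset.range m, v i * ellBasis τ (idx i) z := by
  induction m, hm using Nat.le_induction generalizing g c with
  | base =>
    obtain ⟨d, hd⟩ := hg.exists_eq_const (by simpa using hc)
    exact ⟨fun _ => d, fun z hz => by simp [hd z hz, idx, ellBasis]⟩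
  | succ m hm ih =>
    have hbasis := (hasLeadingTermAt_ellBasis τ (m := m + 1) (by lia)).const_mul c
    obtain ⟨d, hd⟩ := hc.exists_sub (hbasis.of_eq rfl (mul_one c))
    obtain ⟨v, hv⟩ := ih (hg.sub ((isElliptic_ellBasis τ (m + 1)).const_mul c))
      (hd.of_eq (by push_cast; ring) rfl)
    refine ⟨Function.update v m c, fun z hz => ?_⟩
    rw [Finset.sum_range_succ, Function.update_self, sub_eq_iff_eq_add.1 (hv z hz), idx,
      if_neg (by lia)]
    refine congrArg (· + _) (Finset.sum_congr rfl fun i hi => ?_)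
    rw [Function.update_of_ne (Finset.mem_range.1 hi).ne]

theorem idx_ne_one (i : ℕ) : idx i ≠ 1 := by
  grind [idx]

theorem idx_lt {m i : ℕ} (hi : i < m - 1) : idx i < m := by
  grind [idx]

theorem eq_zero_of_orthogonal {m : ℕ} (hm : 2 ≤ m) (hD : momentDet τ m ≠ 0)
    (hg : IsElliptic (periods τ) g) (hc : HasLeadingTermAt g 0 (1 - m) c)
    (horth : ∀ j < m, j ≠ 1 → gammaIntegral τ (fun z => g z * ellBasis τ j z) = 0) :
    ∀ z ∉ (periods τ).lattice, g z = 0 := by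
  obtain ⟨v, hv⟩ := hg.exists_eq_sum (m := m - 1) (by lia) (hc.of_eq (by lia) rfl)
  have hmoment (j : ℕ) : gammaIntegral τ (fun z => g z * ellBasis τ (idx j) z) =
      ∑ i : Fin (m - 1), v i * moment τ (idx i) (idx j) := by
    rw [gammaIntegral_congr (h := fun z => ∑ i ∈ Finset.range (m - 1),
      v i * (ellBasis τ (idx i) z * ellBasis τ (idx j) z)), gammaIntegral_sum, Finset.sum_range]
    · simp only [gammaIntegral_const_mul, moment]
    · exact fun i _ => (((isElliptic_ellBasis τ _).mul (isElliptic_ellBasis τ _)).const_mul _).1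
    · intro z hz
      simp only [hv z hz, Finset.sum_mul, mul_assoc]
  have hv0 : (fun i : Fin (m - 1) => v i) = 0 := by
    refine Matrix.eq_zero_of_vecMul_eq_zero hD (funext fun j => ?_)
    exact (hmoment j).symm.trans (horth (idx j) (idx_lt j.2) (idx_ne_one j))
  intro z hz
  rw [hv z hz, Finset.sum_range]
  exact Finset.sum_eq_zero fun i _ => mul_eq_zero_of_left (congrFun hv0 i) _

end MomentDet

/-- The determinant of the matrix with rows `u` and `v`. -/
def rowDet (u v : Fin 2 → ℂ) : ℂ := u 0 * v 1 - u 1 * v 0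

theorem rowDet_smul_eq (u v w : Fin 2 → ℂ) :
    rowDet u v • w = rowDet w v • u + rowDet u w • v := by
  ext i
  fin_cases i <;> simp [rowDet] <;> ring

/-- The row `(r 0, -r 1)` evaluated at `-z`. -/
def reflect (r : ℂ → Fin 2 → ℂ) (z : ℂ) : Fin 2 → ℂ := ![r (-z) 0, -r (-z) 1]

section JumpRow

variable {τ : UpperHalfPlane} {m : ℕ} {r s u v : ℂ → Fin 2 → ℂ} {z c d κ ρ : ℂ}

/-- A row of a solution of the Riemann-Hilbert problem, after analytic continuation across the
contour from below: the jump `(x, y) ↦ (x, y + x)` becomes a quasi-periodicity of the second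
entry. -/
structure IsJumpRow (τ : UpperHalfPlane) (r : ℂ → Fin 2 → ℂ) : Prop where
  isElliptic : IsElliptic (periods τ) (fun z => r z 0)
  differentiableOn : DifferentiableOn ℂ (fun z => r z 1) ((periods τ).lattice : Set ℂ)ᶜ
  add_one : ∀ z ∉ (periods τ).lattice, r (z + 1) 1 = r z 1
  add_tau : ∀ z ∉ (periods τ).lattice, r (z + τ) 1 = r z 1 - r z 0

/-- A jump row with the leading terms `c z ^ (-m)` and `d z ^ (m - 1)` at `0`. The solution of the
Riemann-Hilbert problem of index `n` has rows of the degrees `n` and `n - 1`. -/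
structure IsJumpRowOfDegree (τ : UpperHalfPlane) (m : ℕ) (r : ℂ → Fin 2 → ℂ) (c d : ℂ) : Prop
    extends IsJumpRow τ r where
  fst : HasLeadingTermAt (fun z => r z 0) 0 (-m) c
  snd : HasLeadingTermAt (fun z => r z 1) 0 (m - 1) d

namespace IsJumpRow

theorem differentiableAt (hr : IsJumpRow τ r) (hz : z ∉ (periods τ).lattice) :
    DifferentiableAt ℂ r z := by
  refine differentiableAt_pi.2 fun i => ?_
  fin_cases i
  · exact hr.1.differentiableAt hz
  · exact hr.2.differentiableAt ((isOpen_compl_lattice _).mem_nhds hz)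

theorem deriv_apply (hr : IsJumpRow τ r) (hz : z ∉ (periods τ).lattice) (i : Fin 2) :
    deriv r z i = deriv (fun w => r w i) z :=
  congrFun (deriv_pi fun i => differentiableAt_pi.1 (hr.differentiableAt hz) i) i

theorem sub (hr : IsJumpRow τ r) (hs : IsJumpRow τ s) : IsJumpRow τ (fun z => r z - s z) where
  isElliptic := hr.1.sub hs.1
  differentiableOn := hr.2.sub hs.2
  add_one z hz := by simp only [Pi.sub_apply, hr.3 z hz, hs.3 z hz]
  add_tau z hz := by simp only [Pi.sub_apply, hr.4 z hz, hs.4 z hz]; ring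

theorem const_smul (hr : IsJumpRow τ r) (c : ℂ) : IsJumpRow τ (fun z => c • r z) where
  isElliptic := hr.1.const_mul c
  differentiableOn := hr.2.const_mul c
  add_one z hz := by simp only [Pi.smul_apply, hr.3 z hz]
  add_tau z hz := by simp only [Pi.smul_apply, hr.4 z hz, smul_sub]

theorem reflect (hr : IsJumpRow τ r) : IsJumpRow τ (reflect r) where
  isElliptic := hr.1.comp_neg
  differentiableOn := (hr.2.comp differentiable_neg.differentiableOn
    fun _ => (periods τ).lattice.neg_mem_iff.not.2).neg
  add_one z hz := by
    have hz' : -(z + 1) ∉ (periods τ).lattice := by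
      rwa [neg_mem_iff, add_mem_cancel_right (one_mem_lattice τ)]
    have hsnd := hr.3 _ hz'
    rw [neg_add_rev, neg_add_cancel_comm] at hsnd
    simpa [EllipticOP.reflect] using hsnd.symm
  add_tau z hz := by
    have hz' : -(z + τ) ∉ (periods τ).lattice := by
      rwa [neg_mem_iff, add_mem_cancel_right (tau_mem_lattice τ)]
    have hfst := hr.1.2 τ (tau_mem_lattice τ) _ hz'
    have hsnd := hr.4 _ hz'
    rw [neg_add_rev, neg_add_cancel_comm] at hfst hsnd
    simp only [EllipticOP.reflect, Matrix.cons_val_zero, Matrix.cons_val_one, neg_add_rev]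
    linear_combination hfst + hsnd

theorem deriv (hr : IsJumpRow τ r) : IsJumpRow τ (deriv r) where
  isElliptic := hr.1.deriv.congr fun z hz => hr.deriv_apply hz 0
  differentiableOn := (hr.2.deriv (isOpen_compl_lattice _)).congr fun z hz => hr.deriv_apply hz 1
  add_one z hz := by
    rw [hr.deriv_apply hz, hr.deriv_apply
      ((add_mem_cancel_right (one_mem_lattice τ)).not.2 hz),
      deriv_apply_add_of_notMem_lattice (g := fun w => r w 1) hr.3 hz]
  add_tau z hz := by
    have hrz := differentiableAt_pi.1 (hr.differentiableAt hz)
    rw [hr.deriv_apply hz, hr.deriv_apply hz, hr.deriv_apply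
      ((add_mem_cancel_right (tau_mem_lattice τ)).not.2 hz),
      deriv_apply_add_of_notMem_lattice (g := fun w => r w 1) hr.4 hz,
      deriv_fun_sub (hrz 1) (hrz 0)]

theorem isElliptic_rowDet (hr : IsJumpRow τ r) (hs : IsJumpRow τ s) :
    IsElliptic (periods τ) (fun z => rowDet (r z) (s z)) := by
  refine .of_add_periods ((hr.1.1.mul hs.2).sub (hr.2.mul hs.1.1)) (fun z hz => ?_) fun z hz => ?_
  · have hr0 := hr.1.2 1 (one_mem_lattice τ) z hz
    have hs0 := hs.1.2 1 (one_mem_lattice τ) z hz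
    simp only [rowDet, periods, hr0, hs0, hr.3 z hz, hs.3 z hz]
  · have hr0 := hr.1.2 τ (tau_mem_lattice τ) z hz
    have hs0 := hs.1.2 τ (tau_mem_lattice τ) z hz
    simp only [rowDet, periods, hr0, hs0, hr.4 z hz, hs.4 z hz]
    ring

theorem gammaIntegral_mul_eq (hr : IsJumpRow τ r) {e : ℂ → ℂ} (he : IsElliptic (periods τ) e)
    (hc : HasLeadingTermAt (fun z => r z 1 * e z) 0 (-1) c) :
    gammaIntegral τ (fun z => r z 0 * e z) = 2 * Real.pi * Complex.I * c := by
  have hdiff : DifferentiableOn ℂ (fun z => r z 1 * e z) ((periods τ).lattice : Set ℂ)ᶜ :=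
    hr.2.mul he.1
  have hdiff' : DifferentiableOn ℂ (fun z => r z 1 * e z + r z 0 * e z)
      ((periods τ).lattice : Set ℂ)ᶜ := hdiff.add (hr.1.1.mul he.1)
  rw [← gammaIntegral_sub_eq_residue hdiff
    (fun z hz => by rw [hr.3 z hz, he.2 1 (one_mem_lattice τ) z hz]) hc,
    gammaIntegral_congr (g := fun z => r (z - τ) 1 * e (z - τ))
      (h := fun z => r z 1 * e z + r z 0 * e z) fun z hz => ?_, ← gammaIntegral_sub hdiff' hdiff]
  · simp only [add_sub_cancel_left]
  · have hz' : z - τ ∉ (periods τ).lattice :=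
      ((periods τ).lattice.sub_mem_iff_left (tau_mem_lattice τ)).not.2 hz
    have hfst := hr.1.2 τ (tau_mem_lattice τ) _ hz'
    have hsnd := hr.4 _ hz'
    have he' := he.2 τ (tau_mem_lattice τ) _ hz'
    rw [sub_add_cancel] at hfst hsnd he'
    rw [he', hsnd, hfst]
    ring

end IsJumpRow

namespace IsJumpRowOfDegree

theorem sub (hr : IsJumpRowOfDegree τ m r c d) (hs : IsJumpRowOfDegree τ m s κ ρ) :
    IsJumpRowOfDegree τ m (fun z => r z - s z) (c - κ) (d - ρ) :=
  ⟨hr.1.sub hs.1, hr.2.sub hs.2, hr.3.sub hs.3⟩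

theorem const_smul (hr : IsJumpRowOfDegree τ m r c d) (a : ℂ) :
    IsJumpRowOfDegree τ m (fun z => a • r z) (a * c) (a * d) :=
  ⟨hr.1.const_smul a, hr.2.const_mul a, hr.3.const_mul a⟩

theorem gammaIntegral_mul_ellBasis_eq_zero (hr : IsJumpRowOfDegree τ m r c d) {j : ℕ}
    (hj : j < m) (hj1 : j ≠ 1) : gammaIntegral τ (fun z => r z 0 * ellBasis τ j z) = 0 := by
  have hres : HasLeadingTermAt (fun z => r z 1 * ellBasis τ j z) 0 (-1) 0 :=
    (hr.snd.mul (hasLeadingTermAt_ellBasis τ hj1)).of_lt (by lia)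
  rw [hr.gammaIntegral_mul_eq (isElliptic_ellBasis τ j) hres, mul_zero]

theorem gammaIntegral_sq (hr : IsJumpRowOfDegree τ m r 1 κ) :
    gammaIntegral τ (fun z => r z 0 ^ 2) = 2 * Real.pi * Complex.I * κ := by
  simp only [sq]
  exact hr.gammaIntegral_mul_eq hr.isElliptic
    ((hr.snd.mul hr.fst).of_eq (by ring) (mul_one κ))

theorem eq_zero (hm : 2 ≤ m) (hD : momentDet τ m ≠ 0) (hr : IsJumpRowOfDegree τ m r 0 d) :
    ∀ z ∉ (periods τ).lattice, r z = 0 := by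
  obtain ⟨a, ha⟩ := hr.fst.exists_add_one
  have h0 := eq_zero_of_orthogonal hm hD hr.isElliptic (ha.of_eq (by ring) rfl)
    fun j hj hj1 => hr.gammaIntegral_mul_ellBasis_eq_zero hj hj1
  have hsnd : IsElliptic (periods τ) (fun z => r z 1) :=
    .of_add_periods hr.differentiableOn hr.add_one
      fun z hz => (hr.add_tau z hz).trans (by rw [h0 z hz, sub_zero])
  have h1 : HasLeadingTermAt (fun z => r z 1) 0 0 0 := hr.snd.of_lt (by lia)
  intro z hz
  ext i
  fin_cases i
  exacts [h0 z hz, hsnd.eq_const h1 hz]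

theorem eq_smul (hm : 2 ≤ m) (hD : momentDet τ m ≠ 0) (hr : IsJumpRowOfDegree τ m r 1 κ)
    (hu : IsJumpRowOfDegree τ m u c d) : ∀ z ∉ (periods τ).lattice, u z = c • r z := by
  have hdiff := hu.sub (hr.const_smul c)
  rw [mul_one, sub_self] at hdiff
  exact fun z hz => sub_eq_zero.1 (hdiff.eq_zero hm hD z hz)

theorem coeff_eq_mul (hm : 2 ≤ m) (hD : momentDet τ m ≠ 0) (hr : IsJumpRowOfDegree τ m r 1 κ)
    (hu : IsJumpRowOfDegree τ m u c d) : d = c * κ := by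
  refine hu.snd.unique ((hr.snd.const_mul c).congr ?_)
  filter_upwards [eventually_notMem_lattice (periods τ) 0] with z hz
  simp [hr.eq_smul hm hD hu z hz]

theorem reflect (hr : IsJumpRowOfDegree τ m r c d) :
    IsJumpRowOfDegree τ m (reflect r) ((-1) ^ m * c) ((-1) ^ m * d) where
  toIsJumpRow := hr.toIsJumpRow.reflect
  fst := by
    have hfst : HasLeadingTermAt (fun z => r z 0) (-0) (-m) c := by
      simpa only [neg_zero] using hr.fst
    refine hfst.comp_neg.of_eq rfl ?_
    simp [← inv_pow, inv_neg]
  snd := by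
    have hsnd : HasLeadingTermAt (fun z => r z 1) (-0) (m - 1) d := by
      simpa only [neg_zero] using hr.snd
    refine hsnd.comp_neg.neg.of_eq rfl ?_
    rw [zpow_sub_one₀ (by norm_num)]
    norm_num

theorem reflect_eq (hm : 2 ≤ m) (hD : momentDet τ m ≠ 0) (hr : IsJumpRowOfDegree τ m r 1 κ)
    (hu : IsJumpRowOfDegree τ m u c d) :
    ∀ z ∉ (periods τ).lattice, EllipticOP.reflect u z = (-1 : ℂ) ^ m • u z := by
  intro z hz
  rw [hr.eq_smul hm hD hu.reflect z hz, hr.eq_smul hm hD hu z hz, mul_smul]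

end IsJumpRowOfDegree

theorem IsEOP.eq_fst {p : ℂ → ℂ} (hp : IsEOP τ m p) (hm : 2 ≤ m)
    (hD : momentDet τ m ≠ 0) (hr : IsJumpRowOfDegree τ m r 1 κ) :
    ∀ z ∉ (periods τ).lattice, p z = r z 0 := by
  have hpE : IsElliptic (periods τ) p := .of_add_periods hp.1.1 hp.1.2 hp.1.3
  have hp1 : HasLeadingTermAt p 0 (-m) 1 :=
    .of_isBigO (eventually_differentiableAt hpE.1 0) (by simpa using hp.1.4)
  obtain ⟨d, hd⟩ := hp1.exists_sub hr.fst
  have hzero := eq_zero_of_orthogonal hm hD (hpE.sub hr.isElliptic) (hd.of_eq (by ring) rfl)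
    fun j hj hj1 => by
      have hE := isElliptic_ellBasis τ j
      simp only [sub_mul]
      rw [gammaIntegral_sub (hpE.mul hE).1 (hr.isElliptic.mul hE).1, hp.2 j hj hj1,
        hr.gammaIntegral_mul_ellBasis_eq_zero hj hj1, sub_zero]
  exact fun z hz => sub_eq_zero.1 (hzero z hz)

end JumpRow

open scoped PeriodPair

theorem IsElliptic.eq_mul_wp'_of_odd {τ : UpperHalfPlane} {g : ℂ → ℂ} {c : ℂ}
    (hg : IsElliptic (periods τ) g) (hc : HasLeadingTermAt g 0 (-3) c)
    (hodd : ∀ z ∉ (periods τ).lattice, g (-z) = -g z) :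
    ∀ z ∉ (periods τ).lattice, g z = -(c / 2) * wp' τ z := by
  have hP := isElliptic_weierstrassP (periods τ)
  have hP' := isElliptic_derivWeierstrassP (periods τ)
  obtain ⟨a, ha⟩ := hc.exists_sub
    (((hasLeadingTermAt_derivWeierstrassP (periods τ)).const_mul (-(c / 2))).of_eq rfl (by ring))
  obtain ⟨b, hb⟩ := ha.exists_sub
    (((hasLeadingTermAt_weierstrassP (periods τ)).const_mul a).of_eq rfl (mul_one a))
  obtain ⟨d, hd⟩ := ((hg.sub (hP'.const_mul _)).sub (hP.const_mul a)).exists_eq_const hb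
  intro z hz
  -- The difference of the two sides is odd by assumption, and even since it is `a ℘ + d`.
  have hneg := hd (-z) (neg_mem_iff.not.2 hz)
  rw [hodd z hz, PeriodPair.weierstrassP_neg, PeriodPair.derivWeierstrassP_neg] at hneg
  have hz := hd z hz
  simp only [wp']
  linear_combination (hz - hneg) / 2

section Reflection

variable {τ : UpperHalfPlane} {r s u v : ℂ → Fin 2 → ℂ} {z ε : ℂ}

theorem rowDet_reflect (u v : ℂ → Fin 2 → ℂ) (z : ℂ) :
    rowDet (reflect u z) (reflect v z) = -rowDet (u (-z)) (v (-z)) := by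
  simp only [rowDet, reflect, Matrix.cons_val_zero, Matrix.cons_val_one]
  ring

theorem reflect_deriv_eq_smul (hr : IsJumpRow τ r)
    (hε : ∀ z ∉ (periods τ).lattice, reflect r z = ε • r z) (hz : z ∉ (periods τ).lattice) :
    reflect (deriv r) z = -ε • deriv r z := by
  have hz' : -z ∉ (periods τ).lattice := neg_mem_iff.not.2 hz
  have hU := (isOpen_compl_lattice (periods τ)).mem_nhds hz
  have hfst : (fun w => r (-w) 0) =ᶠ[𝓝 z] fun w => ε * r w 0 := by
    filter_upwards [hU] with w hw using congrFun (hε w hw) 0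
  have hsnd : (fun w => -r (-w) 1) =ᶠ[𝓝 z] fun w => ε * r w 1 := by
    filter_upwards [hU] with w hw using congrFun (hε w hw) 1
  have hfst' := hfst.deriv_eq
  have hsnd' := hsnd.deriv_eq
  rw [deriv_comp_neg (fun w => r w 0), deriv_const_mul_field, ← hr.deriv_apply hz',
    ← hr.deriv_apply hz] at hfst'
  rw [deriv.fun_neg, deriv_comp_neg (fun w => r w 1), deriv_const_mul_field,
    ← hr.deriv_apply hz', ← hr.deriv_apply hz] at hsnd'
  ext i
  fin_cases i <;> simp only [reflect, Fin.zero_eta, Fin.mk_one, Matrix.cons_val_zero,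
    Matrix.cons_val_one, Pi.smul_apply, smul_eq_mul]
  · linear_combination -hfst'
  · linear_combination -hsnd'

end Reflection

/-- The rows `r` and `s` of a solution of the Riemann-Hilbert problem of index `n`, after analytic
continuation across the contour. -/
structure IsRHPRows (τ : UpperHalfPlane) (n : ℕ) (r s : ℂ → Fin 2 → ℂ) (κ γ : ℂ) : Prop where
  fst : IsJumpRowOfDegree τ n r 1 κ
  snd : IsJumpRowOfDegree τ (n - 1) s γ 1

namespace IsRHPRows

variable {τ : UpperHalfPlane} {n : ℕ} {p q r s u v : ℂ → Fin 2 → ℂ} {z κ₀ γ₀ κ γ κ' γ' : ℂ}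

theorem exists_rowDet_eq (hn : 1 ≤ n) (h : IsRHPRows τ n r s κ γ) :
    ∃ α, ∀ z ∉ (periods τ).lattice, rowDet (r z) (s z) = wp τ z + α := by
  have hdet : HasLeadingTermAt (fun z => rowDet (r z) (s z)) 0 (-2) 1 :=
    ((h.fst.fst.mul h.snd.snd).of_eq (l := -2) (by lia) (mul_one 1)).sub
      ((h.fst.snd.mul h.snd.fst).of_lt (by lia)) |>.of_eq rfl (sub_zero 1)
  obtain ⟨d, hd⟩ := hdet.exists_sub (hasLeadingTermAt_weierstrassP (periods τ))
  obtain ⟨α, hα⟩ := ((h.fst.isElliptic_rowDet h.snd.toIsJumpRow).sub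
    (isElliptic_weierstrassP (periods τ))).exists_eq_const hd
  exact ⟨α, fun z hz => sub_eq_iff_eq_add'.1 (hα z hz)⟩

theorem snd_eq_smul (hn : 2 ≤ n) (hD : momentDet τ n ≠ 0) (h : IsRHPRows τ n r s κ γ)
    (h' : IsRHPRows τ (n + 1) u v κ' γ') :
    γ' * κ = 1 ∧ ∀ z ∉ (periods τ).lattice, v z = γ' • r z :=
  ⟨(h.fst.coeff_eq_mul hn hD h'.snd).symm, h.fst.eq_smul hn hD h'.snd⟩

theorem hasLeadingTermAt_deriv_fst (h : IsRHPRows τ n r s κ γ) :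
    HasLeadingTermAt (fun z => deriv r z 0) 0 (-n - 1) (-n) :=
  (h.fst.fst.deriv.of_eq rfl (by simp)).congr
    ((eventually_notMem_lattice _ 0).mono fun _ hz => h.fst.deriv_apply hz 0)

theorem hasLeadingTermAt_deriv_snd (h : IsRHPRows τ n r s κ γ) :
    HasLeadingTermAt (fun z => deriv r z 1) 0 (n - 2) ((n - 1) * κ) :=
  (h.fst.snd.deriv.of_eq (by ring) (by push_cast; ring)).congr
    ((eventually_notMem_lattice _ 0).mono fun _ hz => h.fst.deriv_apply hz 1)

theorem exists_deriv_fst_eq (hn : 2 ≤ n) (hD : momentDet τ n ≠ 0) (h : IsRHPRows τ n r s κ γ)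
    (h' : IsRHPRows τ (n + 1) u v κ' γ') : ∃ ρ : ℂ, ∀ z ∉ (periods τ).lattice,
      deriv r z = ρ • r z + (((n - 1) * κ) • s z - (n : ℂ) • u z) := by
  have hJ := h.fst.deriv.sub ((h.snd.toIsJumpRow.const_smul ((n - 1) * κ)).sub
    (h'.fst.toIsJumpRow.const_smul n))
  have hu0 := (h'.fst.fst.const_mul n).of_eq (l := -n - 1) (by push_cast; ring) rfl
  have hs1 := (h.snd.snd.const_mul ((n - 1) * κ)).of_eq (l := n - 2) (by lia) rfl
  have hs0 := (h.snd.fst.const_mul ((n - 1) * κ)).of_lt (k := -n - 1) (by lia)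
  have hu1 := (h'.fst.snd.const_mul n).of_lt (k := n - 2) (by lia)
  obtain ⟨a, ha⟩ := h.hasLeadingTermAt_deriv_fst.exists_sub ((hs0.sub hu0).of_eq rfl (by ring))
  obtain ⟨b, hb⟩ := h.hasLeadingTermAt_deriv_snd.exists_sub ((hs1.sub hu1).of_eq rfl (by ring))
  have hdeg : IsJumpRowOfDegree τ n _ a b :=
    ⟨hJ, ha.of_eq (by ring) rfl, hb.of_eq (by ring) rfl⟩
  exact ⟨a, fun z hz => sub_eq_iff_eq_add.1 (h.fst.eq_smul hn hD hdeg z hz)⟩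

theorem rowDet_deriv_fst_snd (hn : 3 ≤ n) (hD₀ : momentDet τ (n - 1) ≠ 0)
    (hD : momentDet τ n ≠ 0) (h₀ : IsRHPRows τ (n - 1) p q κ₀ γ₀) (h : IsRHPRows τ n r s κ γ)
    (hz : z ∉ (periods τ).lattice) : rowDet (deriv r z) (s z) = n / 2 * wp' τ z := by
  have hn1 : 2 ≤ n - 1 := by lia
  have helliptic := h.fst.deriv.isElliptic_rowDet h.snd.toIsJumpRow
  have hlead : HasLeadingTermAt (fun z => rowDet (deriv r z) (s z)) 0 (-3) (-n) :=
    ((h.hasLeadingTermAt_deriv_fst.mul h.snd.snd).of_eq (l := -3) (by lia) (mul_one _)).sub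
      ((h.hasLeadingTermAt_deriv_snd.mul h.snd.fst).of_lt (by lia)) |>.of_eq rfl (sub_zero _)
  rw [helliptic.eq_mul_wp'_of_odd hlead (fun w hw => ?_) z hz]
  · ring
  · have hr := reflect_deriv_eq_smul h.fst.toIsJumpRow (h.fst.reflect_eq (by lia) hD h.fst) hw
    have hs := h₀.fst.reflect_eq hn1 hD₀ h.snd w hw
    have hsign : ((-1 : ℂ) ^ n) = -(-1) ^ (n - 1) := by
      rw [← pow_sub_one_mul (by lia : n ≠ 0), mul_neg_one]
    have hsq : ((-1 : ℂ) ^ (n - 1)) ^ 2 = 1 := by rw [← pow_mul, mul_comm, pow_mul]; simp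
    rw [← neg_inj, ← rowDet_reflect (deriv r) s, hr, hs, hsign]
    simp only [rowDet, Pi.smul_apply, smul_eq_mul]
    linear_combination (deriv r w 0 * s w 1 - deriv r w 1 * s w 0) * hsq

theorem rowDet_fst_deriv_snd (hn : 3 ≤ n) (hD₀ : momentDet τ (n - 1) ≠ 0)
    (hD : momentDet τ n ≠ 0) (h₀ : IsRHPRows τ (n - 1) p q κ₀ γ₀) (h : IsRHPRows τ n r s κ γ)
    (hz : z ∉ (periods τ).lattice) : rowDet (r z) (deriv s z) = (2 - n) / 2 * wp' τ z := by
  obtain ⟨α, hα⟩ := h.exists_rowDet_eq (by lia)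
  have hdet : (fun w => rowDet (r w) (s w)) =ᶠ[𝓝 z] fun w => wp τ w + α := by
    filter_upwards [(isOpen_compl_lattice (periods τ)).mem_nhds hz] using hα
  have hr := differentiableAt_pi.1 (h.fst.differentiableAt hz)
  have hs := differentiableAt_pi.1 (h.snd.differentiableAt hz)
  have hderiv := hdet.deriv_eq
  simp only [rowDet, deriv_add_const] at hderiv
  rw [deriv_fun_sub ((hr 0).fun_mul (hs 1)) ((hr 1).fun_mul (hs 0)), deriv_fun_mul (hr 0) (hs 1),
    deriv_fun_mul (hr 1) (hs 0), ← h.fst.deriv_apply hz, ← h.fst.deriv_apply hz,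
    ← h.snd.deriv_apply hz, ← h.snd.deriv_apply hz] at hderiv
  have hwp : deriv (wp τ) z = wp' τ z := congrFun (periods τ).deriv_weierstrassP z
  have hdiag := rowDet_deriv_fst_snd hn hD₀ hD h₀ h hz
  simp only [rowDet] at hdiag ⊢
  linear_combination hderiv + hwp - hdiag

theorem rowDet_fst_deriv_fst (hn : 2 ≤ n) (hD : momentDet τ n ≠ 0) (h : IsRHPRows τ n r s κ γ)
    (h' : IsRHPRows τ (n + 1) u v κ' γ') (hz : z ∉ (periods τ).lattice) :
    rowDet (r z) (deriv r z) = κ * ((n - 1) * rowDet (r z) (s z) + n * rowDet (u z) (v z)) := by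
  obtain ⟨ρ, hρ⟩ := h.exists_deriv_fst_eq hn hD h'
  obtain ⟨hγκ, hv⟩ := h.snd_eq_smul hn hD h'
  simp only [hρ z hz, hv z hz, rowDet, Pi.add_apply, Pi.sub_apply, Pi.smul_apply, smul_eq_mul]
  linear_combination -n * (u z 0 * r z 1 - u z 1 * r z 0) * hγκ

theorem rowDet_deriv_snd_snd (hn : 3 ≤ n) (hD₀ : momentDet τ (n - 1) ≠ 0)
    (h₀ : IsRHPRows τ (n - 1) p q κ₀ γ₀) (h : IsRHPRows τ n r s κ γ)
    (hz : z ∉ (periods τ).lattice) : rowDet (deriv s z) (s z) =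
      γ * ((2 - n) * rowDet (p z) (q z) + (1 - n) * rowDet (r z) (s z)) := by
  obtain ⟨k, rfl⟩ : ∃ k, n = k + 1 := ⟨n - 1, by lia⟩
  obtain ⟨ρ, hρ⟩ := h₀.exists_deriv_fst_eq (by lia) hD₀ h
  obtain ⟨hγκ, hs⟩ := h₀.snd_eq_smul (by lia) hD₀ h
  have hs' : deriv s z = γ • deriv p z := by
    rw [← deriv_fun_const_smul γ (h₀.fst.differentiableAt hz)]
    exact EventuallyEq.deriv_eq <|
      (eventually_of_mem ((isOpen_compl_lattice (periods τ)).mem_nhds hz) hs)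
  simp only [hs', hρ z hz, hs z hz, rowDet, Pi.add_apply, Pi.sub_apply, Pi.smul_apply, smul_eq_mul]
  push_cast
  linear_combination (k - 1) * γ * (q z 0 * p z 1 - q z 1 * p z 0) * hγκ

theorem gammaIntegral_ne_zero (hn : 2 ≤ n) (hD : momentDet τ n ≠ 0) (h : IsRHPRows τ n r s κ γ)
    (h' : IsRHPRows τ (n + 1) u v κ' γ') : gammaIntegral τ (fun z => r z 0 ^ 2) ≠ 0 := by
  rw [h.fst.gammaIntegral_sq]
  exact mul_ne_zero Complex.two_pi_I_ne_zero
    (right_ne_zero_of_mul_eq_one (h.snd_eq_smul hn hD h').1)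

theorem deriv_eq_laxMatrix_mul (hn : 3 ≤ n) (hD₀ : momentDet τ (n - 1) ≠ 0)
    (hD : momentDet τ n ≠ 0) (h₀ : IsRHPRows τ (n - 1) p q κ₀ γ₀) (h : IsRHPRows τ n r s κ γ)
    (h' : IsRHPRows τ (n + 1) u v κ' γ') (hz : z ∉ (periods τ).lattice)
    (hf : rowDet (r z) (s z) ≠ 0) :
    Matrix.of ![deriv r z, deriv s z] =
      laxMatrix n (gammaIntegral τ (fun z => p z 0 ^ 2)) (gammaIntegral τ (fun z => r z 0 ^ 2))
        (rowDet (p z) (q z)) (rowDet (r z) (s z)) (rowDet (u z) (v z)) (wp' τ z) *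
        Matrix.of ![r z, s z] := by
  have hnorm : gammaIntegral τ (fun z => r z 0 ^ 2) / (2 * Real.pi * Complex.I) = κ := by
    rw [h.fst.gammaIntegral_sq, mul_div_cancel_left₀ _ Complex.two_pi_I_ne_zero]
  have hnorm₀ : 2 * Real.pi * Complex.I / gammaIntegral τ (fun z => p z 0 ^ 2) = γ := by
    have hγκ : γ * κ₀ = 1 := (h₀.fst.coeff_eq_mul (by lia) hD₀ h.snd).symm
    rw [h₀.fst.gammaIntegral_sq, div_mul_cancel_left₀ Complex.two_pi_I_ne_zero]
    exact inv_eq_of_mul_eq_one_left hγκ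
  have hr := rowDet_smul_eq (r z) (s z) (deriv r z)
  have hs := rowDet_smul_eq (r z) (s z) (deriv s z)
  rw [rowDet_deriv_fst_snd hn hD₀ hD h₀ h hz, rowDet_fst_deriv_fst (by lia) hD h h' hz] at hr
  rw [rowDet_deriv_snd_snd hn hD₀ h₀ h hz, rowDet_fst_deriv_snd hn hD₀ hD h₀ h hz] at hs
  rw [laxMatrix, hnorm, hnorm₀, Matrix.smul_mul, one_div, eq_inv_smul_iff₀ hf]
  ext i j
  fin_cases i
  · simpa [Matrix.mul_apply, mul_div_right_comm] using congrFun hr j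
  · simpa [Matrix.mul_apply, mul_div_right_comm] using congrFun hs j

end IsRHPRows

section SecondOrderEquation

variable {a c f fprev fnext d : ℂ → ℂ} {z hprev h : ℂ} {n : ℕ}

theorem deriv_deriv_eq_of_system {L : ℂ → Matrix (Fin 2) (Fin 2) ℂ}
    (hL : ∀ j, DifferentiableAt ℂ (fun w => L w 0 j) z) (ha : DifferentiableAt ℂ a z)
    (hc : DifferentiableAt ℂ c z)
    (hsys : ∀ᶠ w in 𝓝 z, Matrix.mulVec (L w) ![a w, c w] = ![deriv a w, deriv c w])
    (h01 : L z 0 1 ≠ 0) :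
    deriv (deriv a) z = ((L z).trace + deriv (fun w => L w 0 1) z / L z 0 1) * deriv a z +
      (deriv (fun w => L w 0 0) z - deriv (fun w => L w 0 1) z * (L z 0 0 / L z 0 1) -
        (L z).det) * a z := by
  have hfst : deriv a =ᶠ[𝓝 z] fun w => L w 0 0 * a w + L w 0 1 * c w := hsys.mono fun w hw =>
    (congrFun hw 0).symm.trans (Matrix.vec2_dotProduct _ _)
  have hsnd : L z 1 0 * a z + L z 1 1 * c z = deriv c z :=
    (Matrix.vec2_dotProduct _ _).symm.trans (congrFun hsys.self_of_nhds 1)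
  have hderiv := hfst.deriv_eq
  rw [deriv_fun_add ((hL 0).fun_mul ha) ((hL 1).fun_mul hc), deriv_fun_mul (hL 0) ha,
    deriv_fun_mul (hL 1) hc, ← hsnd] at hderiv
  rw [hderiv, hfst.self_of_nhds, Matrix.trace_fin_two, Matrix.det_fin_two]
  field_simp
  ring

theorem laxMatrix_zero_zero (n : ℕ) (hprev h fprev f fnext d : ℂ) :
    laxMatrix n hprev h fprev f fnext d 0 0 = n * d / (2 * f) := by
  simp only [laxMatrix, Matrix.smul_apply, Matrix.of_apply, Matrix.cons_val_zero, smul_eq_mul]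
  ring

theorem laxMatrix_zero_one (n : ℕ) (hprev h fprev : ℂ) {f : ℂ} (hf : f ≠ 0) (fnext d : ℂ) :
    laxMatrix n hprev h fprev f fnext d 0 1 =
      h / (2 * Real.pi * Complex.I) * ((n - 1) + n * (fnext / f)) := by
  simp only [laxMatrix, Matrix.smul_apply, Matrix.of_apply, Matrix.cons_val_zero,
    Matrix.cons_val_one, smul_eq_mul]
  field_simp

theorem trace_laxMatrix (n : ℕ) (hprev h fprev f fnext d : ℂ) :
    (laxMatrix n hprev h fprev f fnext d).trace = d / f := by
  simp only [laxMatrix, Matrix.trace_smul, Matrix.trace_fin_two_of, smul_eq_mul]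
  ring

theorem deriv_deriv_eq_of_laxMatrix (hf : DifferentiableAt ℂ f z)
    (hfnext : DifferentiableAt ℂ fnext z) (hd : DifferentiableAt ℂ d z)
    (ha : DifferentiableAt ℂ a z) (hc : DifferentiableAt ℂ c z)
    (hsys : ∀ᶠ w in 𝓝 z, Matrix.mulVec (laxMatrix n hprev h (fprev w) (f w) (fnext w) (d w))
      ![a w, c w] = ![deriv a w, deriv c w])
    (hh : h ≠ 0) (hfz : f z ≠ 0) (hfnextz : ((n : ℂ) - 1) * f z + n * fnext z ≠ 0) :
    deriv (deriv a) z =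
      (d z / f z + n * deriv (fun w => fnext w / f w) z * ((n - 1) + n * (fnext z / f z))⁻¹) *
        deriv a z +
      (deriv (fun w => n * d w / (2 * f w)) z - n * deriv (fun w => fnext w / f w) z *
          (n * d z / (2 * ((n - 1) * f z + n * fnext z))) -
        (laxMatrix n hprev h (fprev z) (f z) (fnext z) (d z)).det) * a z := by
  set L := fun w => laxMatrix n hprev h (fprev w) (f w) (fnext w) (d w)
  have hratio : DifferentiableAt ℂ (fun w => fnext w / f w) z := hfnext.div hf hfz
  have h00 : (fun w => L w 0 0) = fun w => n * d w / (2 * f w) :=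
    funext fun w => laxMatrix_zero_zero n hprev h (fprev w) (f w) (fnext w) (d w)
  have h01 : (fun w => L w 0 1) =ᶠ[𝓝 z] fun w =>
      h / (2 * Real.pi * Complex.I) * ((n - 1) + n * (fnext w / f w)) :=
    (hf.continuousAt.eventually_ne hfz).mono fun w hw =>
      laxMatrix_zero_one n hprev h (fprev w) hw (fnext w) (d w)
  have hL : ∀ j, DifferentiableAt ℂ (fun w => L w 0 j) z := Fin.forall_fin_two.2
    ⟨h00 ▸ (hd.const_mul _).div (hf.const_mul 2) (mul_ne_zero two_ne_zero hfz),
      h01.differentiableAt_iff.2 (((hratio.const_mul _).const_add _).const_mul _)⟩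
  have hfactor : ((n : ℂ) - 1) * f z + n * fnext z = f z * ((n - 1) + n * (fnext z / f z)) := by
    field_simp
  have hfactor_ne : ((n : ℂ) - 1) + n * (fnext z / f z) ≠ 0 :=
    right_ne_zero_of_mul (hfactor ▸ hfnextz)
  have h01z : L z 0 1 = h / (2 * Real.pi * Complex.I) * ((n - 1) + n * (fnext z / f z)) :=
    laxMatrix_zero_one n hprev h _ hfz _ _
  have h01z_ne : L z 0 1 ≠ 0 :=
    h01z ▸ mul_ne_zero (div_ne_zero hh Complex.two_pi_I_ne_zero) hfactor_ne
  have hlog : deriv (fun w => L w 0 1) z / L z 0 1 =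
      n * deriv (fun w => fnext w / f w) z * ((n - 1) + n * (fnext z / f z))⁻¹ := by
    rw [h01.deriv_eq, h01z, deriv_const_mul_field, deriv_const_add, deriv_const_mul_field,
      mul_div_mul_left _ _ (div_ne_zero hh Complex.two_pi_I_ne_zero), div_eq_mul_inv]
  have hquot : n * d z / (2 * ((n - 1) * f z + n * fnext z)) =
      L z 0 0 * ((n - 1) + n * (fnext z / f z))⁻¹ := by
    rw [hfactor, show L z 0 0 = _ from congrFun h00 z]
    field_simp
  rw [deriv_deriv_eq_of_system hL ha hc hsys h01z_ne, mul_div_left_comm, hlog, h00, hquot,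
    mul_left_comm (L z 0 0), trace_laxMatrix]

end SecondOrderEquation

section LineRemoval

open Complex

variable {E : Type*} [NormedAddCommGroup E] [NormedSpace ℂ E] {F : ℂ → E} {z w p : ℂ} {r y : ℝ}

/-- The integral of `F` over the boundary of the rectangle with opposite corners `z` and `w`. -/
noncomputable def rectangleIntegral (F : ℂ → E) (z w : ℂ) : E :=
  (∫ x : ℝ in z.re..w.re, F (x + z.im * I)) - (∫ x : ℝ in z.re..w.re, F (x + w.im * I)) +
    I • (∫ y : ℝ in z.im..w.im, F (w.re + y * I)) - I • ∫ y : ℝ in z.im..w.im, F (z.re + y * I)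

theorem rectangleIntegral_add_rectangleIntegral (hF : ContinuousOn F (Rectangle z w))
    (hy : y ∈ Set.uIcc z.im w.im) :
    rectangleIntegral F z ⟨w.re, y⟩ + rectangleIntegral F ⟨z.re, y⟩ w =
      rectangleIntegral F z w := by
  have hvertical : ∀ x ∈ Set.uIcc z.re w.re,
      (∫ v : ℝ in z.im..y, F (x + v * I)) + ∫ v : ℝ in y..w.im, F (x + v * I) =
        ∫ v : ℝ in z.im..w.im, F (x + v * I) := by
    intro x hx
    have hint : IntervalIntegrable (fun v : ℝ => F (x + v * I)) MeasureTheory.volume z.im w.im :=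
      (hF.comp (by fun_prop) fun v hv => ⟨by simpa using hx, by simpa using hv⟩).intervalIntegrable
    exact intervalIntegral.integral_add_adjacent_intervals
      (hint.mono_set (Set.uIcc_subset_uIcc_left hy)) (hint.mono_set (Set.uIcc_subset_uIcc_right hy))
  simp only [rectangleIntegral, ← hvertical _ Set.left_mem_uIcc, ← hvertical _ Set.right_mem_uIcc]
  module

theorem rectangleIntegral_eq_zero_of_off_horizontal (hF : ContinuousOn F (Rectangle z w))
    (hd : ∀ u ∈ Rectangle z w, u.im ≠ y → DifferentiableAt ℂ F u) :
    rectangleIntegral F z w = 0 := by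
  have hzero : ∀ z' w' : ℂ, Rectangle z' w' ⊆ Rectangle z w →
      y ∉ Set.Ioo (min z'.im w'.im) (max z'.im w'.im) → rectangleIntegral F z' w' = 0 := by
    intro z' w' hsub hy
    refine integral_boundary_rect_eq_zero_of_continuousOn_of_differentiableOn F z' w'
      (hF.mono hsub) fun u hu => (hd u (hsub ?_) ?_).differentiableWithinAt
    · exact ⟨Set.Ioo_subset_Icc_self hu.1, Set.Ioo_subset_Icc_self hu.2⟩
    · exact fun h => hy (h ▸ hu.2)
  by_cases hy : y ∈ Set.Ioo (min z.im w.im) (max z.im w.im)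
  · have hy' : y ∈ Set.uIcc z.im w.im := Set.Ioo_subset_Icc_self hy
    rw [← rectangleIntegral_add_rectangleIntegral hF hy',
      hzero z ⟨w.re, y⟩ (fun u hu => ⟨hu.1, Set.uIcc_subset_uIcc_left hy' hu.2⟩) (by grind),
      hzero ⟨z.re, y⟩ w (fun u hu => ⟨hu.1, Set.uIcc_subset_uIcc_right hy' hu.2⟩) (by grind),
      add_zero]
  · exact hzero z w subset_rfl hy

theorem differentiableOn_ball_of_off_horizontal [CompleteSpace E]
    (hF : ContinuousOn F (Metric.ball p r))
    (hd : ∀ u ∈ Metric.ball p r, u.im ≠ y → DifferentiableAt ℂ F u) :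
    DifferentiableOn ℂ F (Metric.ball p r) := by
  refine (isConservativeOn_and_continuousOn_iff_isDifferentiableOn Metric.isOpen_ball).1
    ⟨fun z w hzw => ?_, hF⟩
  rw [← add_eq_zero_iff_eq_neg, wedgeIntegral_add_wedgeIntegral_eq]
  exact rectangleIntegral_eq_zero_of_off_horizontal (hF.mono hzw) fun u hu => hd u (hzw hu)

end LineRemoval

section Contour

variable {τ : UpperHalfPlane} {z : ℂ} {m n : ℤ}

/-- The height above the real axis, rescaled such that the components of the contour are the
level lines of integral height. -/
noncomputable def contourHeight (τ : UpperHalfPlane) (z : ℂ) : ℝ := z.im / τ.im + 1 / 2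

/-- The number of the strip between two components of the contour that contains `z`; the strip
around the real axis has the number `0`. -/
noncomputable def stripIndex (τ : UpperHalfPlane) (z : ℂ) : ℤ := ⌊contourHeight τ z⌋

theorem continuous_contourHeight (τ : UpperHalfPlane) : Continuous (contourHeight τ) := by
  unfold contourHeight
  fun_prop

theorem contour_eq_preimage (τ : UpperHalfPlane) :
    contour τ = contourHeight τ ⁻¹' Set.range ((↑) : ℤ → ℝ) := by
  have hτ := τ.im_ne_zero
  ext z
  constructor
  · rintro ⟨t, k, rfl⟩
    refine ⟨k + 1, ?_⟩
    have hk : ((k : ℂ) + 1 / 2) = ((k + 1 / 2 : ℝ) : ℂ) := by push_cast; rfl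
    simp only [contourHeight, hk, Complex.add_im, Complex.ofReal_im, Complex.im_ofReal_mul,
      UpperHalfPlane.coe_im, zero_add]
    field_simp
    push_cast
    ring
  · rintro ⟨k, hk⟩
    refine ⟨z.re - (k - 1 / 2) * τ.re, k - 1, ?_⟩
    have him : z.im = (k - 1 / 2) * τ.im := by
      rw [contourHeight] at hk
      field_simp at hk
      linarith
    have hk' : (((k - 1 : ℤ) : ℂ) + 1 / 2) = ((k - 1 / 2 : ℝ) : ℂ) := by push_cast; ring
    rw [hk']
    apply Complex.ext
    · simp
    · simp only [him, Complex.add_im, Complex.ofReal_im, Complex.im_ofReal_mul,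
        UpperHalfPlane.coe_im, zero_add]

theorem isOpen_compl_contour (τ : UpperHalfPlane) : IsOpen (contour τ)ᶜ := by
  have hrange : IsClosed (Set.range ((↑) : ℤ → ℝ)) := Int.isClosedEmbedding_coe_real.isClosed_range
  exact contour_eq_preimage τ ▸ (hrange.preimage (continuous_contourHeight τ)).isOpen_compl

theorem dense_compl_contour (τ : UpperHalfPlane) : Dense (contour τ)ᶜ := by
  have hopen : IsOpenMap (contourHeight τ) :=
    ((Homeomorph.addRight (1 / 2 : ℝ)).isOpenMap.comp
      (Homeomorph.mulRight₀ _ (inv_ne_zero τ.im_ne_zero)).isOpenMap).comp Complex.isOpenMap_im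
  rw [contour_eq_preimage, ← Set.preimage_compl]
  exact ((Set.countable_range _).dense_compl ℝ).preimage hopen

theorem eventually_im_eq_of_mem_contour (hz : z ∈ contour τ) :
    ∀ᶠ w in 𝓝 z, w ∈ contour τ → w.im = z.im := by
  simp only [contour_eq_preimage] at hz ⊢
  obtain ⟨k, hk⟩ := hz
  filter_upwards [(continuous_contourHeight τ).continuousAt.eventually
    (Metric.ball_mem_nhds _ one_pos)] with w hw ⟨l, hl⟩
  have hlk : l = k := by
    rw [← hl, ← hk, Int.dist_cast_real, Int.dist_eq] at hw
    exact sub_eq_zero.1 (Int.abs_lt_one_iff.1 (by exact_mod_cast hw))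
  have hheight : contourHeight τ w = contourHeight τ z := by rw [← hl, ← hk, hlk]
  simpa [contourHeight, τ.im_ne_zero] using hheight

theorem eventually_stripIndex_eq (hz : z ∉ contour τ) :
    ∀ᶠ w in 𝓝 z, stripIndex τ w = stripIndex τ z := by
  rw [contour_eq_preimage] at hz
  have hlt : (stripIndex τ z : ℝ) < contourHeight τ z :=
    (Int.floor_le _).lt_of_ne fun h => hz ⟨_, h⟩
  filter_upwards [(continuous_contourHeight τ).continuousAt.eventually
    (Ioo_mem_nhds hlt (Int.lt_floor_add_one _))] with w hw
  exact Int.floor_eq_iff.2 ⟨hw.1.le, hw.2⟩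

theorem contourHeight_add (m n : ℤ) (z : ℂ) :
    contourHeight τ (z + (m + n * τ)) = contourHeight τ z + n := by
  have hτ := τ.im_ne_zero
  have him : (z + (m + n * τ)).im = z.im + n * τ.im := by simp
  rw [contourHeight, contourHeight, him]
  field_simp
  ring

theorem stripIndex_add (m n : ℤ) (z : ℂ) :
    stripIndex τ (z + (m + n * τ)) = stripIndex τ z + n := by
  rw [stripIndex, contourHeight_add, Int.floor_add_intCast, stripIndex]

theorem add_mem_contour : z + (m + n * τ) ∈ contour τ ↔ z ∈ contour τ := by
  simp only [contour_eq_preimage, Set.mem_preimage, contourHeight_add, Set.mem_range]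
  exact ⟨fun ⟨k, hk⟩ => ⟨k - n, by push_cast; linarith⟩,
    fun ⟨k, hk⟩ => ⟨k + n, by push_cast; linarith⟩⟩

theorem mem_domain : z ∈ domain τ ↔ z ∉ (periods τ).lattice ∧ z ∉ contour τ := by
  simp [domain, latticeSet]

theorem isOpen_domain (τ : UpperHalfPlane) : IsOpen (domain τ) := by
  rw [domain, Set.compl_union]
  exact (isOpen_compl_lattice _).inter (isOpen_compl_contour τ)

end Contour

section Continuation

variable {τ : UpperHalfPlane} {z ω : ℂ} {n : ℕ} {Y : ℂ → Matrix (Fin 2) (Fin 2) ℂ}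

theorem notMem_lattice_of_mem_contour (hz : z ∈ contour τ) : z ∉ (periods τ).lattice := by
  rw [contour_eq_preimage] at hz
  rw [mem_lattice_periods]
  rintro ⟨m, n, rfl⟩
  obtain ⟨k, hk⟩ := hz
  rw [← zero_add (_ + _), contourHeight_add] at hk
  have htwo : 2 * k = 2 * n + 1 := by
    have hzero : contourHeight τ 0 = 1 / 2 := by simp [contourHeight]
    have : (2 * k : ℝ) = 2 * n + 1 := by rw [hk, hzero]; ring
    exact_mod_cast this
  omega

theorem add_mem_domain (hω : ω ∈ (periods τ).lattice) (hz : z ∈ domain τ) : z + ω ∈ domain τ := by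
  obtain ⟨m, n, rfl⟩ := mem_lattice_periods.1 hω
  exact mem_domain.2 ⟨((periods τ).lattice.add_mem_iff_left hω).not.2 (mem_domain.1 hz).1,
    add_mem_contour.not.2 (mem_domain.1 hz).2⟩

theorem eventually_mem_domain (τ : UpperHalfPlane) :
    ∀ᶠ z in 𝓝[≠] 0, z ∈ domain τ ∧ stripIndex τ z = 0 := by
  have hcontour : (0 : ℂ) ∉ contour τ := fun h =>
    notMem_lattice_of_mem_contour h (zero_mem _)
  have hstrip : stripIndex τ 0 = 0 := by norm_num [stripIndex, contourHeight]
  filter_upwards [(eventually_stripIndex_eq hcontour).filter_mono nhdsWithin_le_nhds,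
    ((isOpen_compl_contour τ).eventually_mem hcontour).filter_mono nhdsWithin_le_nhds,
    eventually_notMem_lattice (periods τ) 0] with z hz hz' hz''
  exact ⟨mem_domain.2 ⟨hz'', hz'⟩, hz.trans hstrip⟩

theorem exists_eq_half_tau_add (hz : z ∈ contour τ) :
    ∃ t ∈ Set.Icc (0 : ℝ) 1, ∃ m n : ℤ, z = τ / 2 + t + (m + n * τ) := by
  obtain ⟨s, k, rfl⟩ := hz
  refine ⟨Int.fract s, ⟨Int.fract_nonneg s, (Int.fract_lt_one s).le⟩, ⌊s⌋, k, ?_⟩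
  have hs : (s : ℂ) = ⌊s⌋ + (Int.fract s : ℝ) := by
    rw [← Complex.ofReal_intCast, ← Complex.ofReal_add, Int.floor_add_fract]
  rw [hs]
  ring

theorem contourHeight_half_tau_add (τ : UpperHalfPlane) (t : ℝ) :
    contourHeight τ (τ / 2 + t) = 1 := by
  have hτ := τ.im_ne_zero
  have him : ((τ : ℂ) / 2 + t).im = τ.im / 2 := by simp
  rw [contourHeight, him]
  field_simp
  norm_num

theorem lt_contourHeight_iff : 1 < contourHeight τ z ↔ (τ : ℂ).im / 2 < z.im := by
  rw [contourHeight, UpperHalfPlane.coe_im, ← sub_lt_iff_lt_add, lt_div_iff₀ τ.im_pos]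
  ring_nf

theorem contourHeight_lt_iff : contourHeight τ z < 1 ↔ z.im < (τ : ℂ).im / 2 := by
  rw [contourHeight, UpperHalfPlane.coe_im, ← lt_sub_iff_add_lt, div_lt_iff₀ τ.im_pos]
  ring_nf

theorem eventually_contourHeight_mem_Ioo (τ : UpperHalfPlane) (t : ℝ) :
    ∀ᶠ z in 𝓝 ((τ : ℂ) / 2 + t), contourHeight τ z ∈ Set.Ioo 0 2 :=
  (continuous_contourHeight τ).continuousAt.eventually
    (Ioo_mem_nhds (by norm_num [contourHeight_half_tau_add])
      (by norm_num [contourHeight_half_tau_add]))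

theorem eventually_stripIndex_eq_one (τ : UpperHalfPlane) (t : ℝ) :
    ∀ᶠ z in 𝓝[{z | (τ : ℂ).im / 2 < z.im}] ((τ : ℂ) / 2 + t), stripIndex τ z = 1 := by
  filter_upwards [self_mem_nhdsWithin,
    (eventually_contourHeight_mem_Ioo τ t).filter_mono nhdsWithin_le_nhds] with z hz hz'
  have hlt := lt_contourHeight_iff.2 hz
  exact Int.floor_eq_iff.2 ⟨by push_cast; exact hlt.le, by push_cast; linarith [hz'.2]⟩

theorem eventually_stripIndex_eq_zero (τ : UpperHalfPlane) (t : ℝ) :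
    ∀ᶠ z in 𝓝[{z | z.im < (τ : ℂ).im / 2}] ((τ : ℂ) / 2 + t), stripIndex τ z = 0 := by
  filter_upwards [self_mem_nhdsWithin,
    (eventually_contourHeight_mem_Ioo τ t).filter_mono nhdsWithin_le_nhds] with z hz hz'
  have hlt := contourHeight_lt_iff.2 hz
  exact Int.floor_eq_iff.2 ⟨by push_cast; exact hz'.1.le, by push_cast; linarith⟩

theorem nhdsWithin_compl_contour_le (τ : UpperHalfPlane) (x : ℂ) :
    𝓝[(contour τ)ᶜ] x ≤
      𝓝[{z | (τ : ℂ).im / 2 < z.im}] x ⊔ 𝓝[{z | z.im < (τ : ℂ).im / 2}] x := by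
  rw [← nhdsWithin_union]
  refine nhdsWithin_mono _ fun z hz => ?_
  have hne : contourHeight τ z ≠ 1 := fun h =>
    hz (contour_eq_preimage τ ▸ ⟨1, by rw [h, Int.cast_one]⟩)
  exact hne.lt_or_gt.symm.imp lt_contourHeight_iff.1 contourHeight_lt_iff.1

theorem extendFrom_eq_of_continuousAt {X E : Type*} [TopologicalSpace X] [TopologicalSpace E]
    [T2Space E] {f : X → E} {A : Set X} {x : X} (hA : Dense A) (hf : ContinuousAt f x) :
    extendFrom A f x = f x :=
  extendFrom_eq (hA x) (hf.tendsto.mono_left nhdsWithin_le_nhds)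

theorem differentiableOn_extendFrom_compl_contour {E : Type*} [NormedAddCommGroup E]
    [NormedSpace ℂ E] [CompleteSpace E] {f : ℂ → E}
    (hf : ∀ z ∈ domain τ, DifferentiableAt ℂ f z)
    (hl : ∀ z ∈ contour τ, ∃ l, Tendsto f (𝓝[(contour τ)ᶜ] z) (𝓝 l)) :
    DifferentiableOn ℂ (extendFrom (contour τ)ᶜ f) ((periods τ).lattice : Set ℂ)ᶜ := by
  have hc : ContinuousOn (extendFrom (contour τ)ᶜ f) ((periods τ).lattice : Set ℂ)ᶜ := by
    refine continuousOn_extendFrom (fun z _ => dense_compl_contour τ z) fun z hz => ?_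
    by_cases h : z ∈ contour τ
    · exact hl z h
    · exact ⟨f z, (hf z (mem_domain.2 ⟨hz, h⟩)).continuousAt.tendsto.mono_left nhdsWithin_le_nhds⟩
  have hdomain : ∀ z ∈ domain τ, DifferentiableAt ℂ (extendFrom (contour τ)ᶜ f) z := fun z hz =>
    (hf z hz).congr_of_eventuallyEq <| by
      filter_upwards [(isOpen_domain τ).mem_nhds hz] with w hw using
        extendFrom_eq_of_continuousAt (dense_compl_contour τ) (hf w hw).continuousAt
  intro z hz
  by_cases h : z ∈ contour τ
  · obtain ⟨r, hr, hball⟩ := Metric.eventually_nhds_iff_ball.1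
      ((eventually_im_eq_of_mem_contour h).and ((isOpen_compl_lattice _).eventually_mem hz))
    have hd := differentiableOn_ball_of_off_horizontal (hc.mono fun w hw => (hball w hw).2)
      fun w hw him => hdomain w (mem_domain.2 ⟨(hball w hw).2, fun h => him ((hball w hw).1 h)⟩)
    exact (hd.differentiableAt (Metric.ball_mem_nhds z hr)).differentiableWithinAt
  · exact (hdomain z (mem_domain.2 ⟨hz, h⟩)).differentiableWithinAt

theorem eqOn_compl_lattice {E : Type*} [TopologicalSpace E] [T2Space E] {f g : ℂ → E}
    (hf : ContinuousOn f ((periods τ).lattice : Set ℂ)ᶜ)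
    (hg : ContinuousOn g ((periods τ).lattice : Set ℂ)ᶜ) (h : Set.EqOn f g (domain τ)) :
    Set.EqOn f g ((periods τ).lattice : Set ℂ)ᶜ := by
  refine h.of_subset_closure hf hg (fun z hz => (mem_domain.1 hz).1) ?_
  rw [domain, Set.compl_union]
  exact (dense_compl_contour τ).open_subset_closure_inter (isOpen_compl_lattice _)

/-- The jump matrix on the contour, raised to the power `c`. -/
def jumpMatrix (c : ℂ) : Matrix (Fin 2) (Fin 2) ℂ := !![1, c; 0, 1]

theorem jumpMatrix_zero : jumpMatrix 0 = 1 := Matrix.one_fin_two.symm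

theorem jumpMatrix_mul (a b : ℂ) : jumpMatrix a * jumpMatrix b = jumpMatrix (a + b) := by
  simp [jumpMatrix, add_comm]

theorem det_jumpMatrix (c : ℂ) : (jumpMatrix c).det = 1 := by
  simp [jumpMatrix]

/-- The function obtained from a solution `Y` of the Riemann-Hilbert problem by undoing the jumps
that are crossed on the way from the real axis to `z`. -/
noncomputable def straighten (τ : UpperHalfPlane) (Y : ℂ → Matrix (Fin 2) (Fin 2) ℂ) (z : ℂ) :
    Matrix (Fin 2) (Fin 2) ℂ :=
  Y z * jumpMatrix (-stripIndex τ z)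

theorem straighten_mul_jumpMatrix (τ : UpperHalfPlane) (Y : ℂ → Matrix (Fin 2) (Fin 2) ℂ) (z : ℂ) :
    straighten τ Y z * jumpMatrix (stripIndex τ z) = Y z := by
  rw [straighten, mul_assoc, jumpMatrix_mul, neg_add_cancel, jumpMatrix_zero, mul_one]

namespace IsRHPSolution

theorem apply_add_lattice (hY : IsRHPSolution τ n Y) (hω : ω ∈ (periods τ).lattice) :
    ∀ z ∈ domain τ, Y (z + ω) = Y z :=
  apply_add_of_mem_lattice (fun _ hω _ => add_mem_domain hω) hY.add_one hY.add_tau hω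

theorem straighten_add (hY : IsRHPSolution τ n Y) (k l : ℤ) (hz : z ∈ domain τ) :
    straighten τ Y (z + (k + l * τ)) = straighten τ Y z * jumpMatrix (-l) := by
  rw [straighten, hY.apply_add_lattice (mem_lattice_periods.2 ⟨k, l, rfl⟩) z hz, stripIndex_add,
    straighten, mul_assoc, jumpMatrix_mul, Int.cast_add, neg_add]

theorem differentiableAt_straighten (hY : IsRHPSolution τ n Y) (hz : z ∈ domain τ) (i : Fin 2) :
    DifferentiableAt ℂ (fun w => straighten τ Y w i) z := by
  refine differentiableAt_pi.2 fun j => DifferentiableAt.congr_of_eventuallyEq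
    (f := fun w => Y w i 0 * jumpMatrix (-stripIndex τ z) 0 j +
      Y w i 1 * jumpMatrix (-stripIndex τ z) 1 j) ?_ ?_
  · exact ((hY.analytic i 0 z hz).differentiableAt.mul_const _).add
      ((hY.analytic i 1 z hz).differentiableAt.mul_const _)
  · filter_upwards [eventually_stripIndex_eq (mem_domain.1 hz).2] with w hw
    rw [straighten, hw, Matrix.mul_apply, Fin.sum_univ_two]

theorem exists_tendsto_straighten_half_tau_add (hY : IsRHPSolution τ n Y) {t : ℝ}
    (ht : t ∈ Set.Icc (0 : ℝ) 1) :
    ∃ M, Tendsto (straighten τ Y) (𝓝[(contour τ)ᶜ] ((τ : ℂ) / 2 + t)) (𝓝 M) := by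
  obtain ⟨Yplus, Yminus, hplus, hminus, hjump⟩ := hY.jump t ht
  have habove : Tendsto (straighten τ Y) (𝓝[{z | (τ : ℂ).im / 2 < z.im}] ((τ : ℂ) / 2 + t))
      (𝓝 Yminus) := by
    have hcancel : Yplus * jumpMatrix (-1) = Yminus := by
      rw [hjump, ← jumpMatrix, mul_assoc, jumpMatrix_mul, add_neg_cancel, jumpMatrix_zero, mul_one]
    refine (hcancel ▸ hplus.mul_const (jumpMatrix (-1))).congr' ?_
    filter_upwards [eventually_stripIndex_eq_one τ t] with z hz
    rw [straighten, hz, Int.cast_one]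
  have hbelow : Tendsto (straighten τ Y) (𝓝[{z | z.im < (τ : ℂ).im / 2}] ((τ : ℂ) / 2 + t))
      (𝓝 Yminus) := by
    refine hminus.congr' ?_
    filter_upwards [eventually_stripIndex_eq_zero τ t] with z hz
    rw [straighten, hz, Int.cast_zero, neg_zero, jumpMatrix_zero, mul_one]
  exact ⟨Yminus, (habove.sup hbelow).mono_left (nhdsWithin_compl_contour_le τ _)⟩

theorem exists_tendsto_straighten (hY : IsRHPSolution τ n Y) (hz : z ∈ contour τ) :
    ∃ M, Tendsto (straighten τ Y) (𝓝[(contour τ)ᶜ] z) (𝓝 M) := by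
  obtain ⟨t, ht, k, l, rfl⟩ := exists_eq_half_tau_add hz
  obtain ⟨M, hM⟩ := hY.exists_tendsto_straighten_half_tau_add ht
  refine ⟨M * jumpMatrix (-l), ?_⟩
  have hmap := (Homeomorph.addRight ((k : ℂ) + l * τ)).isEmbedding.map_nhdsWithin_eq
    (contour τ)ᶜ (τ / 2 + t)
  have himage : Homeomorph.addRight ((k : ℂ) + l * τ) '' (contour τ)ᶜ = (contour τ)ᶜ := by
    have hpreimage : Homeomorph.addRight ((k : ℂ) + l * τ) ⁻¹' (contour τ)ᶜ = (contour τ)ᶜ :=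
      Set.ext fun w => add_mem_contour.not
    exact (congrArg _ hpreimage.symm).trans (Set.image_preimage_eq _ (Homeomorph.surjective _))
  rw [himage, Homeomorph.coe_addRight] at hmap
  rw [← hmap, tendsto_map'_iff]
  refine (hM.mul_const _).congr' ?_
  filter_upwards [self_mem_nhdsWithin, nhdsWithin_le_nhds ((isOpen_compl_lattice _).mem_nhds
    (half_tau_add_notMem_lattice τ t))] with w hw hw'
  exact (hY.straighten_add k l (mem_domain.2 ⟨hw', hw⟩)).symm

theorem exists_isJumpRow (hY : IsRHPSolution τ n Y) (i : Fin 2) :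
    ∃ r, IsJumpRow τ r ∧ ∀ z ∈ domain τ, straighten τ Y z i = r z := by
  set r := extendFrom (contour τ)ᶜ (fun z => straighten τ Y z i)
  have hr : DifferentiableOn ℂ r ((periods τ).lattice : Set ℂ)ᶜ :=
    differentiableOn_extendFrom_compl_contour (fun z hz => hY.differentiableAt_straighten hz i)
      fun z hz => (hY.exists_tendsto_straighten hz).imp' (· i) fun _ h => tendsto_pi_nhds.1 h i
  have heq : ∀ z ∈ domain τ, r z = straighten τ Y z i := fun z hz =>
    extendFrom_eq_of_continuousAt (dense_compl_contour τ)
      (hY.differentiableAt_straighten hz i).continuousAt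
  have hadd (k l : ℤ) : ∀ z ∉ (periods τ).lattice,
      r (z + (k + l * τ)) = Matrix.vecMul (r z) (jumpMatrix (-l)) := by
    have hω : (k + l * τ : ℂ) ∈ (periods τ).lattice := mem_lattice_periods.2 ⟨k, l, rfl⟩
    refine eqOn_compl_lattice (hr.continuousOn.comp (by fun_prop) fun z hz =>
      ((periods τ).lattice.add_mem_iff_left hω).not.2 hz)
      (Continuous.comp_continuousOn (g := (Matrix.vecMul · (jumpMatrix (-l)))) (by fun_prop)
        hr.continuousOn) fun z hz => ?_
    simp only [heq _ (add_mem_domain hω hz), heq z hz, hY.straighten_add k l hz,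
      Matrix.mul_apply_eq_vecMul]
  have hone (j : Fin 2) : ∀ z ∉ (periods τ).lattice, r (z + 1) j = r z j := fun z hz => by
    simpa [jumpMatrix_zero] using congrFun (hadd 1 0 z hz) j
  have htau (j : Fin 2) : ∀ z ∉ (periods τ).lattice,
      r (z + τ) j = Matrix.vecMul (r z) (jumpMatrix (-1)) j := fun z hz => by
    simpa using congrFun (hadd 0 1 z hz) j
  refine ⟨r, ⟨.of_add_periods (differentiableOn_pi.1 hr 0) (hone 0) fun z hz => ?_,
    differentiableOn_pi.1 hr 1, hone 1, fun z hz => ?_⟩, fun z hz => (heq z hz).symm⟩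
  · simpa [periods, jumpMatrix, Matrix.vecMul_eq_sum] using htau 0 z hz
  · simpa [jumpMatrix, Matrix.vecMul_eq_sum, neg_add_eq_sub] using htau 1 z hz

theorem hasLeadingTermAt_row (hY : IsRHPSolution τ n Y) {i : Fin 2} {r : ℂ → Fin 2 → ℂ}
    (hr : IsJumpRow τ r) (heq : ∀ z ∈ domain τ, straighten τ Y z i = r z) :
    HasLeadingTermAt (fun z => r z 0) 0 (-n) ((1 : Matrix (Fin 2) (Fin 2) ℂ) i 0) ∧
      HasLeadingTermAt (fun z => r z 1) 0 (n - 2) ((1 : Matrix (Fin 2) (Fin 2) ℂ) i 1) := by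
  have hnear : ∀ᶠ z in 𝓝[≠] 0, Y z i = r z := by
    filter_upwards [eventually_mem_domain τ] with z hz
    simpa [straighten, hz.2, jumpMatrix_zero] using heq z hz.1
  constructor
  · refine .of_isBigO (eventually_differentiableAt hr.1.1 0)
      ((hY.asymptotic i 0).congr' ?_ (.of_eq (by simp)))
    filter_upwards [hnear] with z hz
    simp [Matrix.mul_apply, hz, mul_comm]
  · refine .of_isBigO (eventually_differentiableAt hr.2 0)
      ((hY.asymptotic i 1).congr' ?_ (.of_eq (by simp)))
    filter_upwards [hnear] with z hz
    simp [Matrix.mul_apply, hz, mul_comm]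

theorem exists_rows (hn : 1 ≤ n) (hY : IsRHPSolution τ n Y) :
    ∃ r s κ γ, IsRHPRows τ n r s κ γ ∧
      ∀ z ∈ domain τ, Y z = Matrix.of ![r z, s z] * jumpMatrix (stripIndex τ z) := by
  obtain ⟨r, hr, hrY⟩ := hY.exists_isJumpRow 0
  obtain ⟨s, hs, hsY⟩ := hY.exists_isJumpRow 1
  obtain ⟨hr0, hr1⟩ := hY.hasLeadingTermAt_row hr hrY
  obtain ⟨hs0, hs1⟩ := hY.hasLeadingTermAt_row hs hsY
  obtain ⟨κ, hκ⟩ := hr1.exists_add_one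
  obtain ⟨γ, hγ⟩ := hs0.exists_add_one
  refine ⟨r, s, κ, γ, ⟨⟨hr, hr0, hκ.of_eq (by ring) rfl⟩,
    ⟨hs, hγ.of_eq (by lia) rfl, hs1.of_eq (by lia) rfl⟩⟩, fun z hz => ?_⟩
  rw [← straighten_mul_jumpMatrix τ Y z, ← hrY z hz, ← hsY z hz]
  congr 1
  ext i j
  fin_cases i <;> rfl

end IsRHPSolution

theorem hasDerivAt_apply_of_rows {r s : ℂ → Fin 2 → ℂ} {L : Matrix (Fin 2) (Fin 2) ℂ}
    (hY : ∀ w ∈ domain τ, Y w = Matrix.of ![r w, s w] * jumpMatrix (stripIndex τ w))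
    (hr : DifferentiableAt ℂ r z) (hs : DifferentiableAt ℂ s z)
    (hL : Matrix.of ![deriv r z, deriv s z] = L * Matrix.of ![r z, s z]) (hz : z ∈ domain τ)
    (i j : Fin 2) : HasDerivAt (fun w => Y w i j) ((L * Y z) i j) z := by
  have hentry (k : Fin 2) : HasDerivAt (fun w => Matrix.of ![r w, s w] i k)
      (Matrix.of ![deriv r z, deriv s z] i k) z := by
    fin_cases i
    · exact hasDerivAt_pi.1 hr.hasDerivAt k
    · exact hasDerivAt_pi.1 hs.hasDerivAt k
  have hsum := ((hentry 0).mul_const (jumpMatrix (stripIndex τ z) 0 j)).add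
    ((hentry 1).mul_const (jumpMatrix (stripIndex τ z) 1 j))
  rw [hY z hz, ← mul_assoc, ← hL, Matrix.mul_apply, Fin.sum_univ_two]
  refine hsum.congr_of_eventuallyEq ?_
  filter_upwards [(isOpen_domain τ).mem_nhds hz,
    eventually_stripIndex_eq (mem_domain.1 hz).2] with w hw hstrip
  rw [hY w hw, hstrip, Matrix.mul_apply, Fin.sum_univ_two]
  rfl

end Continuation

variable {τ : UpperHalfPlane} {n : ℕ} {z κ₀ γ₀ κ γ κ' γ' α : ℂ} {p₀ p f₀ f f' : ℂ → ℂ}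
  {Y : ℂ → Matrix (Fin 2) (Fin 2) ℂ} {r₀ s₀ r s u v : ℂ → Fin 2 → ℂ}

theorem IsRHPSolution.exists_rows_det (hn : 1 ≤ n) (hY : IsRHPSolution τ n Y) :
    ∃ (r s : ℂ → Fin 2 → ℂ) (κ γ : ℂ) (f : ℂ → ℂ) (α : ℂ), IsRHPRows τ n r s κ γ ∧
      (∀ z ∈ domain τ, Y z = Matrix.of ![r z, s z] * jumpMatrix (stripIndex τ z)) ∧
      (∀ z, f z = wp τ z + α) ∧ (∀ z ∉ (periods τ).lattice, rowDet (r z) (s z) = f z) ∧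
      ∀ z ∈ domain τ, (Y z).det = f z := by
  obtain ⟨r, s, κ, γ, h, hrows⟩ := hY.exists_rows hn
  obtain ⟨α, hα⟩ := h.exists_rowDet_eq hn
  refine ⟨r, s, κ, γ, fun z => wp τ z + α, α, h, hrows, fun _ => rfl, hα, fun z hz => ?_⟩
  rw [hrows z hz, Matrix.det_mul, det_jumpMatrix, mul_one, Matrix.det_fin_two]
  exact hα z (mem_domain.1 hz).1

theorem differentiableAt_of_eq_wp_add (hf : ∀ w, f w = wp τ w + α)
    (hz : z ∉ (periods τ).lattice) : DifferentiableAt ℂ f z := by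
  rw [funext hf]
  exact ((isElliptic_weierstrassP (periods τ)).differentiableAt hz).add_const α

namespace IsRHPRows

theorem gammaIntegral_eop_sq (hn : 2 ≤ n) (hD : momentDet τ n ≠ 0)
    (h : IsRHPRows τ n r s κ γ) (hp : IsEOP τ n p) :
    gammaIntegral τ (fun z => p z ^ 2) = gammaIntegral τ (fun z => r z 0 ^ 2) :=
  gammaIntegral_congr fun z hz => by rw [hp.eq_fst hn hD h.fst z hz]

theorem gammaIntegral_eop_sq_ne_zero (hn : 2 ≤ n) (hD : momentDet τ n ≠ 0)
    (h : IsRHPRows τ n r s κ γ) (h' : IsRHPRows τ (n + 1) u v κ' γ') (hp : IsEOP τ n p) :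
    gammaIntegral τ (fun z => p z ^ 2) ≠ 0 :=
  h.gammaIntegral_eop_sq hn hD hp ▸ h.gammaIntegral_ne_zero hn hD h'

theorem deriv_eq_laxMatrix_mul_of_eop (hn : 3 ≤ n) (hD₀ : momentDet τ (n - 1) ≠ 0)
    (hD : momentDet τ n ≠ 0) (h₀ : IsRHPRows τ (n - 1) r₀ s₀ κ₀ γ₀)
    (h : IsRHPRows τ n r s κ γ) (h' : IsRHPRows τ (n + 1) u v κ' γ')
    (hp₀ : IsEOP τ (n - 1) p₀) (hp : IsEOP τ n p)
    (hf₀ : ∀ z ∉ (periods τ).lattice, rowDet (r₀ z) (s₀ z) = f₀ z)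
    (hf : ∀ z ∉ (periods τ).lattice, rowDet (r z) (s z) = f z)
    (hf' : ∀ z ∉ (periods τ).lattice, rowDet (u z) (v z) = f' z)
    (hz : z ∉ (periods τ).lattice) (hfz : f z ≠ 0) :
    Matrix.of ![deriv r z, deriv s z] =
      laxMatrix n (gammaIntegral τ (fun z => p₀ z ^ 2)) (gammaIntegral τ (fun z => p z ^ 2))
        (f₀ z) (f z) (f' z) (wp' τ z) * Matrix.of ![r z, s z] := by
  rw [h₀.gammaIntegral_eop_sq (by lia) hD₀ hp₀, h.gammaIntegral_eop_sq (by lia) hD hp,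
    ← hf₀ z hz, ← hf z hz, ← hf' z hz]
  exact h₀.deriv_eq_laxMatrix_mul hn hD₀ hD h h' hz (by rwa [hf z hz])

theorem mulVec_eq_deriv_eop (h : IsRHPRows τ n r s κ γ) (hn : 2 ≤ n)
    (hD : momentDet τ n ≠ 0) (hp : IsEOP τ n p) {L : Matrix (Fin 2) (Fin 2) ℂ}
    (hz : z ∉ (periods τ).lattice)
    (hL : Matrix.of ![deriv r z, deriv s z] = L * Matrix.of ![r z, s z]) :
    Matrix.mulVec L ![p z, s z 0] = ![deriv p z, deriv (fun w => s w 0) z] := by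
  have hpr : p =ᶠ[𝓝 z] fun w => r w 0 := by
    filter_upwards [(isOpen_compl_lattice _).mem_nhds hz] with w hw
      using hp.eq_fst hn hD h.fst w hw
  rw [hpr.deriv_eq, hpr.self_of_nhds, ← h.fst.deriv_apply hz, ← h.snd.deriv_apply hz]
  ext i
  have hentry := congrFun (congrFun hL i) 0
  rw [Matrix.mul_apply, Fin.sum_univ_two] at hentry
  fin_cases i
  · simpa [Matrix.mulVec_eq_sum, mul_comm] using hentry.symm
  · simpa [Matrix.mulVec_eq_sum, mul_comm] using hentry.symm

end IsRHPRows

end EllipticOP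

theorem proposition3p2 (τ : UpperHalfPlane) (n : ℕ) (hn : 3 ≤ n)
    (hDprev : EllipticOP.momentDet τ (n - 1) ≠ 0)
    (hD : EllipticOP.momentDet τ n ≠ 0)
    (hDnext : EllipticOP.momentDet τ (n + 1) ≠ 0)
    -- the solutions of the Riemann-Hilbert problems of index `n - 1`, `n`, `n + 1`
    (Yprev Y Ynext : ℂ → Matrix (Fin 2) (Fin 2) ℂ)
    (hYprev : EllipticOP.IsRHPSolution τ (n - 1) Yprev)
    (hY : EllipticOP.IsRHPSolution τ n Y)
    (hYnext : EllipticOP.IsRHPSolution τ (n + 1) Ynext)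
    -- the elliptic orthogonal polynomials of degree `n - 1` and `n`, and their norms
    (pprev p : ℂ → ℂ)
    (hpprev : EllipticOP.IsEOP τ (n - 1) pprev)
    (hp : EllipticOP.IsEOP τ n p)
    (hprev h : ℂ)
    (hhprev : hprev = EllipticOP.gammaIntegral τ (fun z => pprev z ^ 2))
    (hh : h = EllipticOP.gammaIntegral τ (fun z => p z ^ 2)) :
    hprev ≠ 0 ∧ h ≠ 0 ∧
    ∃ fprev f fnext : ℂ → ℂ,
      -- `f_m` is the determinant of `Y_m`, of the form `℘ + α_m`
      (∃ αprev α αnext : ℂ,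
        (∀ z, fprev z = EllipticOP.wp τ z + αprev) ∧
        (∀ z, f z = EllipticOP.wp τ z + α) ∧
        (∀ z, fnext z = EllipticOP.wp τ z + αnext)) ∧
      (∀ z ∈ EllipticOP.domain τ,
        (Yprev z).det = fprev z ∧ (Y z).det = f z ∧ (Ynext z).det = fnext z) ∧
      ∃ L : ℂ → Matrix (Fin 2) (Fin 2) ℂ,
        (∀ z, L z = EllipticOP.laxMatrix n hprev h (fprev z) (f z) (fnext z)
          (EllipticOP.wp' τ z)) ∧
        -- `Y' = L Y`
        (∀ z ∈ EllipticOP.domain τ, f z ≠ 0 →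
          ∀ i j, HasDerivAt (fun w => Y w i j) ((L z * Y z) i j) z) ∧
        -- the second-order differential equation for `π_n`
        (∀ z ∉ EllipticOP.latticeSet τ, f z ≠ 0 →
          ((n : ℂ) - 1) * f z + (n : ℂ) * fnext z ≠ 0 →
          deriv (deriv p) z =
            (EllipticOP.wp' τ z / f z
              + (n : ℂ) * deriv (fun w => fnext w / f w) z
                * (((n : ℂ) - 1) + (n : ℂ) * (fnext z / f z))⁻¹) * deriv p z
            + (deriv (fun w => (n : ℂ) * EllipticOP.wp' τ w / (2 * f w)) z
              - (n : ℂ) * deriv (fun w => fnext w / f w) z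
                * ((n : ℂ) * EllipticOP.wp' τ z
                  / (2 * (((n : ℂ) - 1) * f z + (n : ℂ) * fnext z)))
              - (L z).det) * p z) := by
  open EllipticOP in
  subst hhprev hh
  obtain ⟨r₀, s₀, _, _, f₀, α₀, R₀, -, hα₀, hdet₀, hdetY₀⟩ := hYprev.exists_rows_det (by lia)
  obtain ⟨r, s, κ, γ, f, α, R, hrows, hα, hdet, hdetY⟩ := hY.exists_rows_det (by lia)
  obtain ⟨r', s', _, _, f', α', R', -, hα', hdet', hdetY'⟩ := hYnext.exists_rows_det (by lia)
  have hR : IsRHPRows τ (n - 1 + 1) r s κ γ := by rwa [Nat.sub_add_cancel (by lia)]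
  have hh := R.gammaIntegral_eop_sq_ne_zero (by lia) hD R' hp
  have hlax := fun {z} => R₀.deriv_eq_laxMatrix_mul_of_eop (z := z) hn hDprev hD R R' hpprev hp
    hdet₀ hdet hdet'
  refine ⟨R₀.gammaIntegral_eop_sq_ne_zero (by lia) hDprev hR hpprev, hh, f₀, f, f',
    ⟨α₀, α, α', hα₀, hα, hα'⟩, fun z hz => ⟨hdetY₀ z hz, hdetY z hz, hdetY' z hz⟩, _,
    fun _ => rfl, fun z hz hfz => ?_, fun z hz hfz hfz' => ?_⟩
  · have hz' := (mem_domain.1 hz).1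
    exact hasDerivAt_apply_of_rows hrows (R.fst.differentiableAt hz') (R.snd.differentiableAt hz')
      (hlax hz' hfz) hz
  · have hnhds := (isOpen_compl_lattice (periods τ)).mem_nhds hz
    have hf : DifferentiableAt ℂ f z := differentiableAt_of_eq_wp_add hα hz
    refine deriv_deriv_eq_of_laxMatrix hf (differentiableAt_of_eq_wp_add hα' hz)
      ((isElliptic_derivWeierstrassP (periods τ)).differentiableAt hz)
      (hp.differentiableOn.differentiableAt hnhds) (R.snd.isElliptic.differentiableAt hz) ?_ hh
      hfz hfz'
    filter_upwards [hnhds, hf.continuousAt.eventually_ne hfz] with w hw hfw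
    exact R.mulVec_eq_deriv_eop (by lia) hD hp hw (hlax hw hfw)
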